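/- \textbf{Setting.} Let $h_1,h_2,\dots$ be algebraically independent over $\mathbb R$, $h_0=1$, $h_z=0$ for $z<0$, and let $\Lambda=\mathbb R[h_1,h_2,\dots]$ be the ring of symmetric functions. For a partition $\lambda$ put $s_\lambda=\det(h_{\lambda_i-i+j})_{1\le i,j\le l(\lambda)}$; let $\langle\cdot,\cdot\rangle$ be the inner product on $\Lambda$ for which the basis $(s_\lambda)$ is orthonormal. Let $[\lambda,\rho]$ denote an interval of the dominance order $\trianglelefteq$ on partitions of $N$. For a finite multiset $A$ of nonempty partitions with at most two parts, let $s_A=\prod_{\lambda\in A}s_\lambda$ and let $\phi(A)$ be the partition formed by all parts of all members of $A$. $A$ is \emph{nested} if no two members $\lambda,\mu$ of $A$ (counted with multiplicity, in either order) satisfy one of: (1) both have two parts and $\lambda_1>\mu_1\ge\lambda_2>\mu_2$; (2) $\lambda$ has two parts, $\lambda_1>\lambda_2$, $\mu$ has one part, and $\lambda_1\ge\mu_1\ge\lambda_2$; (3) both have one part. Let $\mathcal{SSP}_\lambda$ be the set of nested $A$ with $\phi(A)=\lambda$, and $\mathcal{SSP}_N=\bigcup_{\lambda\vdash N}\mathcal{SSP}_\lambda$.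 For $A\in\mathcal{SSP}_N$ with $\phi(A)=\lambda$, a function $f\in\Lambda$ \emph{separates $A$ on $[\lambda,\rho]$} if $\langle f,s_\mu\rangle=0$ for all $\mu\notin[\lambda,\rho]$, $\langle f,s_A\rangle>0$, and $\langle f,s_B\rangle\le 0$ for all $B\in\mathcal{SSP}_N$ with $B\ne A$ and $\phi(B)\in[\lambda,\rho]$. Let $\lambda=(\lambda_1\ge\dots\ge\lambda_m>0)$; it is called even or odd according to the parity of $m$. For $m=2k$ or $m=2k+1$, $\lambda^{++}$ is obtained by adding $1$ to the first $k$ parts and subtracting $1$ from the last $k$ parts. If $\lambda_{m-1}>\lambda_m$, put $$\lambda^\dagger=\begin{cases}(\lambda_1+1,\dots,\lambda_{k-1}+1,\lambda_k,\lambda_{k+1}-1,\dots,\lambda_{m-1}-1,\lambda_m)&(m=2k)\\(\lambda_1+1,\dots,\lambda_k+1,\lambda_{k+1}-1,\dots,\lambda_{m-1}-1,\lambda_m)&(m=2k+1).\end{cases}$$ Put $\lambda{\uparrow}=(\lambda_1+1,\dots,\lambda_m+1,1)$ and $\lambda{\downarrow}=(\lambda_1-1,\dots,\lambda_m-1)$;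 $\lambda$ is \emph{$\downarrow$-invertible} if $\lambda_{m-1}>\lambda_m=1$. $A{\downarrow}$ is obtained by subtracting $1$ from each part of each member of $A$ and discarding empty partitions; $A{\uparrow}$ by adding $1$ to each part of each member of $A$ and giving each one-part member an additional part $1$. \textbf{Conjecture I.} For every $N$ and every $A\in\mathcal{SSP}_N$ with $\phi(A)=\lambda$ there is an $f$ that separates $A$ on $[\lambda,\lambda^{++}]$. \textbf{Conjecture II.} Let $A\in\mathcal{SSP}_N$ with $\phi(A)=\lambda$ even. If $\lambda$ is $\downarrow$-invertible and $A{\downarrow}\in\mathcal{SSP}_{\lambda\downarrow}$, then some $f$ separates $A$ on $[\lambda,\lambda^\dagger]$. Otherwise some $f$ separates $A$ on $[\lambda,\lambda^{++}]$. \textbf{Theorem.} Conjecture II implies Conjecture I. Moreover, let $A\in\mathcal{SSP}_N$ with $\phi(A)=\lambda$, where $\lambda$ has an odd number $m$ of parts. For a partition $\rho$ with at most $m$ parts, let $\hat\rho=(\rho_1+1,\dots,\rho_{m+1}+1)$, with $\rho_i=0$ for $i>l(\rho)$ (so $\hat\rho=\rho{\uparrow}$ if $l(\rho)=m$). For $B\in\mathcal{SSP}_N$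 with $\phi(B)\in[\lambda,\lambda^{++}]$, let $\hat B$ be $B{\uparrow}$ together with $\frac{m+1}2-|B|$ additional copies of $(1,1)$. Then: \begin{enumerate} \item $\lambda{\uparrow}$ is $\downarrow$-invertible and $A{\uparrow}\in\mathcal{SSP}_{\lambda\uparrow}$. \item $\rho\mapsto\hat\rho$ is an isomorphism of posets from $[\lambda,\lambda^{++}]$ onto $[\lambda{\uparrow},(\lambda{\uparrow})^\dagger]$. \item For every $B\in\mathcal{SSP}_N$ with $\phi(B)\in[\lambda,\lambda^{++}]$ one has $\hat B\in\mathcal{SSP}_{\widehat{\phi(B)}}$, $\hat B=B{\uparrow}$ if $\phi(B)$ has $m$ parts, and $\langle s_\rho,s_B\rangle=\langle s_{\hat\rho},s_{\hat B}\rangle$ for all $\rho\in[\lambda,\lambda^{++}]$. \item If some $f$ separates $A{\uparrow}$ on $[\lambda{\uparrow},(\lambda{\uparrow})^\dagger]$, then some $g$ separates $A$ on $[\lambda,\lambda^{++}]$. \end{enumerate} -/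

import Mathlib

noncomputable section

namespace SchurCone

/-! ## Partitions

A partition is a `YoungDiagram`.  Its parts are its row lengths, numbered from `0`, so that
the part `lam_i` of the usual notation is `lam.rowLen (i - 1)`; `lam.rowLen i = 0` beyond the
last row.  The size of a partition is `lam.card`. -/

/-- The number of parts of a partition. -/
def numParts (lam : YoungDiagram) : ℕ := lam.colLen 0

/-- The multiset of the (positive) parts of a partition. -/
def parts (lam : YoungDiagram) : Multiset ℕ := (lam.rowLens : Multiset ℕ)

/-- The partition with a given multiset of parts. -/
def ofParts (s : Multiset ℕ) : YoungDiagram :=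
  YoungDiagram.ofRowLens (s.sort (· ≥ ·)) (s.pairwise_sort (· ≥ ·)).sortedGE

/-- The partition whose parts are the nonzero entries of the weakly decreasing vector
`(f 0, f 1, …, f (n - 1))`. -/
def ofSeq (n : ℕ) (f : ℕ → ℕ) (hf : ∀ i j, i < j → j < n → f j ≤ f i) : YoungDiagram :=
  YoungDiagram.ofRowLens ((List.range n).map f) (by
    refine List.Pairwise.sortedGE (List.pairwise_map.2 ?_)
    refine List.Pairwise.imp_of_mem ?_ (List.pairwise_lt_range (n := n))
    intro a b _ hb hab
    exact hf a b hab (List.mem_range.1 hb))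

/-- Dominance order: `Dom mu lam` says that `lam` dominates `mu`; the two
partitions have the same size and the partial sums of `lam` are at least those of `mu`. -/
def Dom (mu lam : YoungDiagram) : Prop :=
  mu.card = lam.card ∧
    ∀ n, ∑ i ∈ Finset.range n, mu.rowLen i ≤ ∑ i ∈ Finset.range n, lam.rowLen i

/-- The interval `[lam, rho]` in the dominance order. -/
def interval (lam rho : YoungDiagram) : Set YoungDiagram := {mu | Dom lam mu ∧ Dom mu rho}

/-! ## Symmetric functions -/

/-- The ring of symmetric functions (with real coefficients) as the polynomial ring in the
algebraically independent elements `h_1, h_2, …`; the variable `X i` is `h_{i+1}`. -/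
abbrev Sym : Type := MvPolynomial ℕ ℝ

/-- `h_z` for an integer `z`, with `h_0 = 1` and `h_z = 0` for `z < 0`. -/
def hsymm (z : ℤ) : Sym :=
  if z < 0 then 0 else if z = 0 then 1 else MvPolynomial.X (z.toNat - 1)

/-- The Schur function `s_lam = det (h_{lam_i - i + j})`, by the Jacobi-Trudi identity. -/
def schur (lam : YoungDiagram) : Sym :=
  Matrix.det (Matrix.of fun i j : Fin (numParts lam) =>
    hsymm ((lam.rowLen i : ℤ) - (i : ℤ) + (j : ℤ)))

/-! ### The Schur functions form a basis -/

theorem parts_ofParts {s : Multiset ℕ} (hs : ∀ x ∈ s, 0 < x) : parts (ofParts s) = s := by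
  unfold parts ofParts
  rw [YoungDiagram.rowLens_ofRowLens_eq_self]
  · exact Multiset.sort_eq s _
  · intro x hx
    exact hs x ((Multiset.mem_sort _).1 hx)

theorem parts_injective : Function.Injective parts := by
  intro a b hab
  apply YoungDiagram.equivListRowLens.injective
  apply Subtype.ext
  exact List.Perm.eq_of_pairwise' a.rowLens_sorted.pairwise b.rowLens_sorted.pairwise
    (Multiset.coe_eq_coe.1 hab)

theorem pos_of_mem_parts {lam : YoungDiagram} {x : ℕ} (hx : x ∈ parts lam) : 0 < x :=
  lam.pos_of_mem_rowLens x (by simpa [parts] using hx)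

/-- The exponent vector of the monomial `h_lam`. -/
def expo (lam : YoungDiagram) : ℕ →₀ ℕ := Multiset.toFinsupp ((parts lam).map (fun k => k - 1))

theorem map_pred_succ {s : Multiset ℕ} (hs : ∀ x ∈ s, 0 < x) :
    (s.map (fun k => k - 1)).map (fun k => k + 1) = s := by
  rw [Multiset.map_map]
  conv_rhs => rw [← Multiset.map_id s]
  refine Multiset.map_congr rfl fun x hx => ?_
  have := hs x hx
  simp only [Function.comp, id]
  omega

theorem expo_injective : Function.Injective expo := by
  intro a b hab
  apply parts_injective
  have h1 : (parts a).map (fun k => k - 1) = (parts b).map (fun k => k - 1) :=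
    Multiset.toFinsupp.injective hab
  rw [← map_pred_succ (s := parts a) fun x hx => pos_of_mem_parts hx, h1,
    map_pred_succ fun x hx => pos_of_mem_parts hx]

theorem expo_surjective : Function.Surjective expo := by
  intro e
  refine ⟨ofParts ((Finsupp.toMultiset e).map (fun k => k + 1)), ?_⟩
  unfold expo
  rw [parts_ofParts (by simp), Multiset.map_map]
  simp

theorem expo_eq_sum (lam : YoungDiagram) :
    expo lam = ∑ i : Fin (numParts lam), Finsupp.single (lam.rowLen i - 1) 1 := by
  have h1 : parts lam = ∑ i : Fin (numParts lam), {lam.rowLen i} := by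
    unfold parts YoungDiagram.rowLens numParts
    rw [Fin.sum_univ_eq_sum_range (fun i => ({lam.rowLen i} : Multiset ℕ)) (lam.colLen 0)]
    simp only [Finset.sum, Finset.range_val, Multiset.range, Multiset.map_coe,
      Multiset.sum_coe]
    generalize List.range (lam.colLen 0) = l
    induction l with
    | nil => simp
    | cons a l ih =>
      simp only [List.map_cons, List.sum_cons, ← ih]
      rw [← Multiset.cons_coe, Multiset.singleton_add]
  unfold expo
  rw [h1, ← Multiset.coe_mapAddMonoidHom, map_sum, map_sum]
  simp

/-- The total degree and the sum of squares of the parts of `h_lam`, read off the exponents. -/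
def wt : (ℕ →₀ ℕ) →+ ℕ := Finsupp.weight fun i => i + 1

/-- The sum of squares of the parts, read off the exponent vector. -/
def sq : (ℕ →₀ ℕ) →+ ℕ := Finsupp.weight fun i => (i + 1) ^ 2

theorem sq_le_wt_sq (e : ℕ →₀ ℕ) : sq e ≤ wt e ^ 2 := by
  induction e using Finsupp.induction_linear with
  | zero => simp
  | add a b ha hb => rw [map_add, map_add]; nlinarith [Nat.zero_le (wt a * wt b)]
  | single i c =>
    simp only [sq, wt, Finsupp.weight_single, smul_eq_mul]
    rw [mul_pow]
    exact Nat.mul_le_mul_right _ (Nat.le_self_pow (by norm_num) c)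

theorem prod_hsymm {n : ℕ} (z : Fin n → ℤ) :
    ∏ i, hsymm (z i) = 0 ∨ ∃ e, ∏ i, hsymm (z i) = MvPolynomial.monomial e 1 ∧
      (wt e : ℤ) = ∑ i, z i ∧ (sq e : ℤ) = ∑ i, z i ^ 2 := by
  by_cases hz : ∃ i, z i < 0
  · obtain ⟨i, hi⟩ := hz
    exact Or.inl (Finset.prod_eq_zero (Finset.mem_univ i) (by simp [hsymm, hi]))
  · push Not at hz
    right
    have key : ∀ i, ∃ e, hsymm (z i) = MvPolynomial.monomial e 1 ∧ (wt e : ℤ) = z i ∧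
        (sq e : ℤ) = z i ^ 2 := by
      intro i
      rcases (hz i).eq_or_lt with h0 | h0
      · exact ⟨0, by simp [hsymm, ← h0], by simp [← h0], by simp [← h0]⟩
      · obtain ⟨k, hk⟩ : ∃ k : ℕ, z i = k + 1 := ⟨(z i - 1).toNat, by omega⟩
        refine ⟨Finsupp.single k 1, ?_, ?_, ?_⟩
        · have h1 : ¬ (k : ℤ) + 1 < 0 := by omega
          have h2 : ¬ (k : ℤ) + 1 = 0 := by omega
          have h3 : ((k : ℤ) + 1).toNat - 1 = k := by omega
          simp only [hsymm, hk, h1, h2, h3, if_false]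
          rfl
        · simp [wt, Finsupp.weight_single, hk]
        · simp [sq, Finsupp.weight_single, hk]
    choose e he using key
    refine ⟨∑ i, e i, ?_, ?_, ?_⟩
    · rw [MvPolynomial.monomial_sum_one]
      exact Finset.prod_congr rfl fun i _ => (he i).1
    · rw [map_sum]; push_cast; exact Finset.sum_congr rfl fun i _ => (he i).2.1
    · rw [map_sum]; push_cast; exact Finset.sum_congr rfl fun i _ => (he i).2.2

theorem rowLen_pos (lam : YoungDiagram) (i : Fin (numParts lam)) : 0 < lam.rowLen i :=
  YoungDiagram.mem_iff_lt_rowLen.1 (YoungDiagram.mem_iff_lt_colLen.2 i.2)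

theorem wt_expo (lam : YoungDiagram) :
    (wt (expo lam) : ℤ) = ∑ i : Fin (numParts lam), (lam.rowLen i : ℤ) := by
  rw [expo_eq_sum, map_sum]
  push_cast
  refine Finset.sum_congr rfl fun i _ => ?_
  have := rowLen_pos lam i
  simp only [wt, Finsupp.weight_single, one_smul]
  omega

theorem sq_expo (lam : YoungDiagram) :
    (sq (expo lam) : ℤ) = ∑ i : Fin (numParts lam), (lam.rowLen i : ℤ) ^ 2 := by
  rw [expo_eq_sum, map_sum]
  push_cast
  refine Finset.sum_congr rfl fun i _ => ?_
  have h1 : lam.rowLen i - 1 + 1 = lam.rowLen i := by have := rowLen_pos lam i; omega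
  simp [sq, Finsupp.weight_single, h1]

theorem sum_perm_shift (lam : YoungDiagram) (s : Equiv.Perm (Fin (numParts lam))) :
    ∑ i, ((lam.rowLen (s i) : ℤ) - ((s i : ℕ) : ℤ) + ((i : ℕ) : ℤ)) =
      ∑ i : Fin (numParts lam), (lam.rowLen i : ℤ) := by
  rw [Finset.sum_add_distrib, Finset.sum_sub_distrib,
    Equiv.sum_comp s (fun i => (lam.rowLen i : ℤ)),
    Equiv.sum_comp s (fun i => ((i : ℕ) : ℤ))]
  ring

theorem sum_sq_perm_shift (lam : YoungDiagram) (s : Equiv.Perm (Fin (numParts lam)))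
    (hs : s ≠ 1) :
    ∑ i : Fin (numParts lam), (lam.rowLen i : ℤ) ^ 2 <
      ∑ i, ((lam.rowLen (s i) : ℤ) - ((s i : ℕ) : ℤ) + ((i : ℕ) : ℤ)) ^ 2 := by
  have e1 : ∑ i, ((lam.rowLen (s i) : ℤ) - ((s i : ℕ) : ℤ) + ((i : ℕ) : ℤ)) ^ 2 =
      ∑ i : Fin (numParts lam),
        ((lam.rowLen i : ℤ) - ((i : ℕ) : ℤ) + ((s⁻¹ i : ℕ) : ℤ)) ^ 2 := by
    rw [← Equiv.sum_comp s (fun i : Fin (numParts lam) => ((lam.rowLen i : ℤ) - ((i : ℕ) : ℤ) +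
      ((s⁻¹ i : ℕ) : ℤ)) ^ 2)]
    simp
  rw [e1]
  have hanti : Antivary (fun i : Fin (numParts lam) => (lam.rowLen i : ℤ))
      (fun i => ((i : ℕ) : ℤ)) := by
    intro i j hij
    have h1 : (i : ℕ) < (j : ℕ) := Int.ofNat_lt.1 hij
    exact Int.ofNat_le.2 (lam.rowLen_anti i j h1.le)
  have h1 := hanti.sum_mul_le_sum_mul_comp_perm (σ := s⁻¹)
  have h2 : 0 < ∑ i : Fin (numParts lam), (((s⁻¹ i : ℕ) : ℤ) - ((i : ℕ) : ℤ)) ^ 2 := by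
    obtain ⟨i, hi⟩ : ∃ i, s⁻¹ i ≠ i := by
      by_contra! hc
      exact hs (inv_eq_one.1 (Equiv.ext hc))
    refine Finset.sum_pos' (fun _ _ => sq_nonneg _) ⟨i, Finset.mem_univ i, ?_⟩
    have : ((s⁻¹ i : ℕ) : ℤ) - ((i : ℕ) : ℤ) ≠ 0 := by
      intro h0
      apply hi
      apply Fin.ext
      omega
    positivity
  have e2 : ∑ i : Fin (numParts lam), ((lam.rowLen i : ℤ) - ((i : ℕ) : ℤ) + ((s⁻¹ i : ℕ) : ℤ)) ^ 2 =
      ∑ i : Fin (numParts lam), (lam.rowLen i : ℤ) ^ 2 +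
      2 * (∑ i : Fin (numParts lam), (lam.rowLen i : ℤ) * ((s⁻¹ i : ℕ) : ℤ) -
        ∑ i : Fin (numParts lam), (lam.rowLen i : ℤ) * ((i : ℕ) : ℤ)) +
      ∑ i : Fin (numParts lam), (((s⁻¹ i : ℕ) : ℤ) - ((i : ℕ) : ℤ)) ^ 2 := by
    rw [← Finset.sum_sub_distrib, Finset.mul_sum, ← Finset.sum_add_distrib,
      ← Finset.sum_add_distrib]
    exact Finset.sum_congr rfl fun i _ => by ring
  rw [e2]
  linarith

/-- `s_lam` is `h_lam` plus a combination of monomials of the same degree with a larger sum of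
squares of parts. -/
theorem schur_eq (lam : YoungDiagram) :
    ∃ r : Sym, schur lam = MvPolynomial.monomial (expo lam) 1 + r ∧
      ∀ e ∈ r.support, wt e = wt (expo lam) ∧ sq (expo lam) < sq e := by
  classical
  refine ⟨∑ s ∈ Finset.univ.erase (1 : Equiv.Perm (Fin (numParts lam))),
    Equiv.Perm.sign s • ∏ i, hsymm ((lam.rowLen (s i) : ℤ) - ((s i : ℕ) : ℤ) + ((i : ℕ) : ℤ)),
    ?_, ?_⟩
  · unfold schur
    rw [Matrix.det_apply, ← Finset.add_sum_erase _ _ (Finset.mem_univ 1)]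
    congr 1
    rw [expo_eq_sum, MvPolynomial.monomial_sum_one]
    simp only [Equiv.Perm.sign_one, one_smul, Equiv.Perm.coe_one, id, Matrix.of_apply]
    refine Finset.prod_congr rfl fun i _ => ?_
    have := rowLen_pos lam i
    have h1 : ¬ (lam.rowLen i : ℤ) < 0 := by omega
    have h2 : ¬ (lam.rowLen i : ℤ) = 0 := by omega
    simp only [sub_add_cancel, hsymm, h1, h2, if_false, Int.toNat_natCast]
    rfl
  · intro e he
    have h1 := MvPolynomial.support_sum he
    obtain ⟨s, hs, hes⟩ := Finset.mem_biUnion.1 h1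
    have hs1 : s ≠ 1 := (Finset.mem_erase.1 hs).1
    rcases prod_hsymm (fun i => (lam.rowLen (s i) : ℤ) - ((s i : ℕ) : ℤ) + ((i : ℕ) : ℤ)) with
      h0 | ⟨e', h0, hw, hq⟩
    · rw [h0] at hes
      simp at hes
    · rw [h0] at hes
      have : e = e' := by
        rw [MvPolynomial.mem_support_iff] at hes
        by_contra hne
        apply hes
        have h3 : MvPolynomial.coeff e (MvPolynomial.monomial e' (1 : ℝ)) = 0 := by
          rw [MvPolynomial.coeff_monomial, if_neg (Ne.symm hne)]
        rcases Int.units_eq_one_or (Equiv.Perm.sign s) with hu | hu <;> simp [hu, h3]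
      subst this
      rw [sum_perm_shift, ← wt_expo] at hw
      have h4 := sum_sq_perm_shift lam s hs1
      rw [← hq, ← sq_expo] at h4
      exact ⟨by exact_mod_cast hw, by exact_mod_cast h4⟩

theorem linearIndependent_schur : LinearIndependent ℝ schur := by
  classical
  rw [linearIndependent_iff]
  intro c hc
  by_contra hne
  obtain ⟨mu, hmu, hmin⟩ := Finset.exists_min_image c.support (fun nu => sq (expo nu))
    (Finsupp.support_nonempty_iff.2 hne)
  have h1 : MvPolynomial.coeff (expo mu) (Finsupp.linearCombination ℝ schur c) = c mu := by
    rw [Finsupp.linearCombination_apply, Finsupp.sum, MvPolynomial.coeff_sum,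
      Finset.sum_eq_single mu]
    · obtain ⟨r, hr, hsupp⟩ := schur_eq mu
      have : MvPolynomial.coeff (expo mu) r = 0 := by
        by_contra h0
        exact lt_irrefl _ (hsupp _ (MvPolynomial.mem_support_iff.2 h0)).2
      rw [MvPolynomial.coeff_smul, hr, MvPolynomial.coeff_add, this]
      simp
    · intro nu hnu hnm
      obtain ⟨r, hr, hsupp⟩ := schur_eq nu
      have h2 : MvPolynomial.coeff (expo mu) r = 0 := by
        by_contra h0
        exact absurd (hsupp _ (MvPolynomial.mem_support_iff.2 h0)).2 (not_lt.2 (hmin nu hnu))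
      rw [MvPolynomial.coeff_smul, hr, MvPolynomial.coeff_add, h2,
        MvPolynomial.coeff_monomial, if_neg (fun h0 => hnm (expo_injective h0))]
      simp
    · intro h0
      exact absurd hmu h0
  rw [hc] at h1
  exact (Finsupp.mem_support_iff.1 hmu) (by simpa using h1.symm)

theorem monomial_mem_span_schur (k : ℕ) : ∀ e : ℕ →₀ ℕ, wt e ^ 2 - sq e = k →
    MvPolynomial.monomial e (1 : ℝ) ∈ Submodule.span ℝ (Set.range schur) := by
  induction k using Nat.strong_induction_on with
  | _ k ih =>
    intro e hk
    obtain ⟨mu, rfl⟩ := expo_surjective e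
    obtain ⟨r, hr, hsupp⟩ := schur_eq mu
    rw [eq_sub_iff_add_eq.2 hr.symm]
    refine Submodule.sub_mem _ (Submodule.subset_span ⟨mu, rfl⟩) ?_
    rw [r.as_sum]
    refine Submodule.sum_mem _ fun e he => ?_
    obtain ⟨hw, hq⟩ := hsupp e he
    have h1 := sq_le_wt_sq e
    rw [← mul_one (MvPolynomial.coeff e r), ← smul_eq_mul, ← MvPolynomial.smul_monomial]
    refine Submodule.smul_mem _ _ (ih _ ?_ e rfl)
    rw [hw] at h1 ⊢
    omega

theorem span_schur : ⊤ ≤ Submodule.span ℝ (Set.range schur) := by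
  intro f _
  rw [f.as_sum]
  refine Submodule.sum_mem _ fun e _ => ?_
  rw [← mul_one (MvPolynomial.coeff e f), ← smul_eq_mul, ← MvPolynomial.smul_monomial]
  exact Submodule.smul_mem _ _ (monomial_mem_span_schur _ e rfl)

/-- The basis of the ring of symmetric functions consisting of the Schur functions. -/
def schurBasis : Module.Basis YoungDiagram ℝ Sym :=
  Module.Basis.mk linearIndependent_schur span_schur

/-- The standard inner product, for which the Schur functions are orthonormal. -/
def innp (f g : Sym) : ℝ :=
  (schurBasis.repr f).sum fun mu c => c * schurBasis.repr g mu

theorem innp_schur (lam mu : YoungDiagram) [Decidable (lam = mu)] :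
    innp (schur lam) (schur mu) = if lam = mu then 1 else 0 := by
  classical
  have h1 : ∀ nu, schurBasis.repr (schur nu) = Finsupp.single nu 1 := by
    intro nu
    rw [← schurBasis.repr_self nu, schurBasis, Module.Basis.mk_apply]
  rw [innp, h1, h1, Finsupp.sum_single_index (by simp), Finsupp.single_apply]
  by_cases hlm : lam = mu
  · simp [hlm]
  · simp [hlm, Ne.symm hlm]

/-! ## Multisets of partitions with at most two parts -/

/-- `s_A`, the product of the Schur functions of the members of `A`. -/
def schurProd (A : Multiset YoungDiagram) : Sym := (A.map schur).prod

/-- `phi A`, the partition formed by all the parts of all the members of `A`. -/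
def phi (A : Multiset YoungDiagram) : YoungDiagram := ofParts (A.bind parts)

/-- The three conditions on an (ordered) pair of partitions that are forbidden in a nested
multiset. -/
def Crossing (lam mu : YoungDiagram) : Prop :=
  (numParts lam = 2 ∧ numParts mu = 2 ∧
    mu.rowLen 0 < lam.rowLen 0 ∧ lam.rowLen 1 ≤ mu.rowLen 0 ∧ mu.rowLen 1 < lam.rowLen 1) ∨
  (numParts lam = 2 ∧ lam.rowLen 1 < lam.rowLen 0 ∧ numParts mu = 1 ∧
    mu.rowLen 0 ≤ lam.rowLen 0 ∧ lam.rowLen 1 ≤ mu.rowLen 0) ∨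
  (numParts lam = 1 ∧ numParts mu = 1)

/-- No pair of members (with multiplicity) of `A` is in one of the three forbidden positions. -/
def Nested (A : Multiset YoungDiagram) : Prop :=
  ∀ lam mu : YoungDiagram, ({lam, mu} : Multiset YoungDiagram) ≤ A → ¬ Crossing lam mu

/-- `SP N`: multisets of (nonempty) partitions with at most two parts, of total size `N`. -/
def SP (N : ℕ) : Set (Multiset YoungDiagram) :=
  {A | (∀ lam ∈ A, 1 ≤ numParts lam ∧ numParts lam ≤ 2) ∧ (A.map YoungDiagram.card).sum = N}

/-- The nested members of `SP N`. -/
def SSP (N : ℕ) : Set (Multiset YoungDiagram) := {A | A ∈ SP N ∧ Nested A}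

/-- The nested multisets whose parts form the partition `lam`. -/
def SSPshape (lam : YoungDiagram) : Set (Multiset YoungDiagram) :=
  {A | A ∈ SSP lam.card ∧ phi A = lam}

/-- `f` separates `A` on the interval `[lam, rho]` (used for `A` in `SSP N`, `phi A = lam`). -/
structure SeparatesOn (N : ℕ) (f : Sym) (A : Multiset YoungDiagram) (lam rho : YoungDiagram) :
    Prop where
  support : ∀ mu, mu ∉ interval lam rho → innp f (schur mu) = 0
  pos : 0 < innp f (schurProd A)
  nonpos : ∀ B ∈ SSP N, phi B ∈ interval lam rho → B ≠ A → innp f (schurProd B) ≤ 0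

/-! ## The operations on partitions -/

/-- `lam⁺⁺`: with `m = 2k` or `m = 2k + 1` parts, add `1` to the first `k` parts, subtract `1`
from the last `k` parts, and keep the middle part (if `m` is odd). -/
def plusPlus (lam : YoungDiagram) : YoungDiagram :=
  ofSeq (numParts lam)
    (fun i =>
      if i < numParts lam / 2 then lam.rowLen i + 1
      else if numParts lam % 2 = 1 ∧ i = numParts lam / 2 then lam.rowLen i
      else lam.rowLen i - 1)
    (by
      intro i j hij _
      have := lam.rowLen_anti i j hij.le
      split_ifs <;> omega)

/-- The last two parts of `lam` are different, `lam_{m-1} > lam_m`. -/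
def LastDrop (lam : YoungDiagram) : Prop :=
  2 ≤ numParts lam ∧ lam.rowLen (numParts lam - 1) < lam.rowLen (numParts lam - 2)

/-- `lam†`, for `lam_{m-1} > lam_m`: keep the last part; if `m = 2k`, add `1` to the first
`k - 1` parts, keep the `k`-th part and subtract `1` from the parts number `k + 1` to `m - 1`;
if `m = 2k + 1`, add `1` to the first `k` parts and subtract `1` from the parts number `k + 1`
to `m - 1`. -/
def dagger (lam : YoungDiagram) (hlam : LastDrop lam) : YoungDiagram :=
  ofSeq (numParts lam)
    (fun i =>
      if i + 1 = numParts lam then lam.rowLen i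
      else if numParts lam % 2 = 0 then
        if i + 1 < numParts lam / 2 then lam.rowLen i + 1
        else if i + 1 = numParts lam / 2 then lam.rowLen i
        else lam.rowLen i - 1
      else
        if i < numParts lam / 2 then lam.rowLen i + 1
        else lam.rowLen i - 1)
    (by
      intro i j hij hj
      have h1 := lam.rowLen_anti i j hij.le
      obtain ⟨h2, h3⟩ := hlam
      have h4 : i ≤ numParts lam - 2 := by omega
      have h5 := lam.rowLen_anti i (numParts lam - 2) h4
      have h6 : j + 1 = numParts lam → lam.rowLen j = lam.rowLen (numParts lam - 1) := by
        intro h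
        congr 1
        omega
      split_ifs <;> omega)

/-- Add a first column of length `n`, that is, add `1` to each of the first `n` entries
(meant for partitions with at most `n` parts, some of the first `n` entries may be `0`). -/
def addCol (n : ℕ) (mu : YoungDiagram) : YoungDiagram :=
  ofSeq n (fun i => mu.rowLen i + 1)
    (fun i j hij _ => Nat.add_le_add_right (mu.rowLen_anti i j hij.le) 1)

/-- `mu↑ = (mu_1 + 1, …, mu_m + 1, 1)`. -/
def up (mu : YoungDiagram) : YoungDiagram := addCol (numParts mu + 1) mu

/-- `mu↓ = (mu_1 - 1, …, mu_m - 1)`. -/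
def down (mu : YoungDiagram) : YoungDiagram :=
  ofSeq (numParts mu) (fun i => mu.rowLen i - 1)
    (fun i j hij _ => Nat.sub_le_sub_right (mu.rowLen_anti i j hij.le) 1)

/-- `mu_{m-1} > mu_m = 1`. -/
def DownInvertible (mu : YoungDiagram) : Prop :=
  LastDrop mu ∧ mu.rowLen (numParts mu - 1) = 1

/-- `A↓`: subtract `1` from each part of each member of `A` (and discard empty partitions). -/
def downSet (A : Multiset YoungDiagram) : Multiset YoungDiagram :=
  open Classical in (A.map down).filter (fun mu => mu ≠ ⊥)

/-- `A↑` for members with one or two parts: add `1` to each part of each member of `A` and give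
the one-part members a new part `1`. -/
def upSet (A : Multiset YoungDiagram) : Multiset YoungDiagram := A.map (addCol 2)

/-- `B` completed by empty partitions to a multiset of `(m + 1) / 2` partitions,
followed by `↑`; an empty partition becomes `(1, 1)`. -/
def upSetPad (m : ℕ) (B : Multiset YoungDiagram) : Multiset YoungDiagram :=
  upSet (B + Multiset.replicate ((m + 1) / 2 - B.card) ⊥)

/-! ## The two conjectures -/

/-- Every nested `A` with `phi A = lam` can be separated on `[lam, lam⁺⁺]`. -/
def PlusPlusConjecture : Prop :=
  ∀ (N : ℕ) (A : Multiset YoungDiagram), A ∈ SSP N →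
    ∃ f : Sym, SeparatesOn N f A (phi A) (plusPlus (phi A))

/-- Let `A` be nested with `lam = phi A` even.  If `lam` is `↓`-invertible and `A↓` is a nested
multiset of shape `lam↓`, then `A` can be separated on `[lam, lam†]`; otherwise `A` can be
separated on `[lam, lam⁺⁺]`. -/
def StrongConjecture : Prop :=
  ∀ (N : ℕ) (A : Multiset YoungDiagram), A ∈ SSP N → Even (numParts (phi A)) →
    (∀ hlam : DownInvertible (phi A), downSet A ∈ SSPshape (down (phi A)) →
      ∃ f : Sym, SeparatesOn N f A (phi A) (dagger (phi A) hlam.1)) ∧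
    (¬ (DownInvertible (phi A) ∧ downSet A ∈ SSPshape (down (phi A))) →
      ∃ f : Sym, SeparatesOn N f A (phi A) (plusPlus (phi A)))

end SchurCone

end

noncomputable section

namespace SchurCone


/-! ## Row lengths and the dominance order -/

/-! Adding a first column of length m + 1 shifts partial sums uniformly, so it preserves dominance;
for odd m it carries λ⁺⁺ to (λ↑)† (`dagger_up`). This identifies the two intervals.

The coefficients are compared through the ring homomorphism h_z ↦ h_z + t h_{z-1}. By Jacobi-Trudi
it sends s_ν to a polynomial in t of degree at most n when ν has at most n parts, with
t^n-coefficient s_{ν↓} if ν has exactly n parts and 0 otherwise. A nested B whose shape has p parts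
has ⌈p/2⌉ members, so padding with empty partitions to (m + 1)/2 members and applying ↑ gives
two-row factors with m + 1 parts in all. Top coefficients multiply, so the t^(m+1)-coefficient of
the image of s_B̂ is s_B. Hence s_ρ̂ has the same coefficient in s_B̂ as s_ρ has in s_B
(`repr_schurProd_upSetPad`), and s_ν ↦ s_{ν↓} turns a function separating A↑ into one separating A.

For the implication between the conjectures, odd shapes reduce in this way to the †-case of the even
shape λ↑. For even shapes λ† ⊴ λ⁺⁺, and enlarging the interval is harmless: s_B involves only s_μ
with μ ⊵ φ(B), so a newly admitted B pairs to 0 with f (`SeparatesOn.mono`). -/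

theorem lt_numParts_iff {mu : YoungDiagram} {i : ℕ} : i < numParts mu ↔ 0 < mu.rowLen i :=
  YoungDiagram.mem_iff_lt_colLen.symm.trans YoungDiagram.mem_iff_lt_rowLen

theorem rowLen_eq_zero_iff {mu : YoungDiagram} {i : ℕ} : mu.rowLen i = 0 ↔ numParts mu ≤ i := by
  have := lt_numParts_iff (mu := mu) (i := i)
  omega

theorem ext_rowLen {mu nu : YoungDiagram} (h : ∀ i, mu.rowLen i = nu.rowLen i) : mu = nu := by
  ext ⟨i, j⟩
  rw [YoungDiagram.mem_cells, YoungDiagram.mem_cells, YoungDiagram.mem_iff_lt_rowLen,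
    YoungDiagram.mem_iff_lt_rowLen, h i]

theorem rowLen_ofSeq (n : ℕ) (f : ℕ → ℕ) (hf : ∀ i j, i < j → j < n → f j ≤ f i) (i : ℕ) :
    (ofSeq n f hf).rowLen i = if i < n then f i else 0 := by
  split_ifs with hi
  · have h := YoungDiagram.rowLen_ofRowLens (w := (List.range n).map f)
      (hw := by
        refine List.Pairwise.sortedGE (List.pairwise_map.2 ?_)
        refine List.Pairwise.imp_of_mem ?_ (List.pairwise_lt_range (n := n))
        intro a b _ hb hab
        exact hf a b hab (List.mem_range.1 hb)) ⟨i, by simpa using hi⟩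
    simpa [ofSeq] using h
  · by_contra h0
    have h1 : (i, 0) ∈ ofSeq n f hf :=
      YoungDiagram.mem_iff_lt_rowLen.2 (Nat.pos_of_ne_zero h0)
    rw [ofSeq, YoungDiagram.mem_ofRowLens] at h1
    obtain ⟨h2, -⟩ := h1
    simp at h2
    exact hi h2

theorem rowLen_bot (i : ℕ) : (⊥ : YoungDiagram).rowLen i = 0 := by
  by_contra h
  exact YoungDiagram.notMem_bot (i, 0)
    (YoungDiagram.mem_iff_lt_rowLen.2 (Nat.pos_of_ne_zero h))

theorem numParts_bot : numParts ⊥ = 0 :=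
  Nat.le_zero.1 (rowLen_eq_zero_iff.1 (rowLen_bot 0))

theorem card_eq_sum_rowLen {mu : YoungDiagram} {n : ℕ} (hn : numParts mu ≤ n) :
    mu.card = ∑ i ∈ Finset.range n, mu.rowLen i := by
  have h : ∀ c ∈ mu.cells, c.1 ∈ Finset.range n := by
    rintro ⟨i, j⟩ hc
    have h1 : 0 < mu.rowLen i :=
      (Nat.zero_le j).trans_lt (YoungDiagram.mem_iff_lt_rowLen.1 (YoungDiagram.mem_cells _ |>.1 hc))
    exact Finset.mem_range.2 ((lt_numParts_iff.2 h1).trans_le hn)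
  unfold YoungDiagram.card
  rw [Finset.card_eq_sum_card_fiberwise h]
  exact Finset.sum_congr rfl fun i _ => (mu.rowLen_eq_card).symm

theorem sum_rowLen_le_card (mu : YoungDiagram) (n : ℕ) :
    ∑ i ∈ Finset.range n, mu.rowLen i ≤ mu.card := by
  rw [card_eq_sum_rowLen (le_max_left (numParts mu) n)]
  exact Finset.sum_le_sum_of_subset (Finset.range_mono (le_max_right _ _))

theorem Dom.trans {a b c : YoungDiagram} (h1 : Dom a b) (h2 : Dom b c) : Dom a c :=
  ⟨h1.1.trans h2.1, fun n => (h1.2 n).trans (h2.2 n)⟩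

/-- The first `numParts a` rows of `a` already exhaust the common size, so those of `b` do too and
no row is left. -/
theorem Dom.numParts_le {a b : YoungDiagram} (h : Dom a b) : numParts b ≤ numParts a := by
  rw [← rowLen_eq_zero_iff]
  have h1 := h.2 (numParts a)
  rw [← card_eq_sum_rowLen le_rfl, h.1] at h1
  have h2 := sum_rowLen_le_card b (numParts a + 1)
  rw [Finset.sum_range_succ] at h2
  omega

/-! ### Adding and removing a first column -/

theorem rowLen_addCol (n : ℕ) (mu : YoungDiagram) (i : ℕ) :
    (addCol n mu).rowLen i = if i < n then mu.rowLen i + 1 else 0 :=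
  rowLen_ofSeq _ _ _ i

theorem rowLen_down (mu : YoungDiagram) (i : ℕ) : (down mu).rowLen i = mu.rowLen i - 1 := by
  rw [down, rowLen_ofSeq]
  split_ifs with h
  · rfl
  · have := rowLen_eq_zero_iff.2 (not_lt.1 h)
    omega

theorem numParts_addCol (n : ℕ) (mu : YoungDiagram) : numParts (addCol n mu) = n := by
  refine le_antisymm (rowLen_eq_zero_iff.1 (by simp [rowLen_addCol])) ?_
  by_contra! h
  have := rowLen_eq_zero_iff.2 (le_refl (numParts (addCol n mu)))
  rw [rowLen_addCol, if_pos h] at this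
  omega

theorem down_addCol {n : ℕ} {mu : YoungDiagram} (h : numParts mu ≤ n) :
    down (addCol n mu) = mu := by
  refine ext_rowLen fun i => ?_
  rw [rowLen_down, rowLen_addCol]
  split_ifs with hi
  · rfl
  · exact (rowLen_eq_zero_iff.2 (h.trans (not_lt.1 hi))).symm

theorem addCol_down {n : ℕ} {mu : YoungDiagram} (h : numParts mu = n) :
    addCol n (down mu) = mu := by
  refine ext_rowLen fun i => ?_
  rw [rowLen_addCol, rowLen_down]
  split_ifs with hi
  · have := lt_numParts_iff.1 (h.symm ▸ hi)
    omega
  · exact (rowLen_eq_zero_iff.2 (h.le.trans (not_lt.1 hi))).symm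

theorem numParts_down_le (mu : YoungDiagram) : numParts (down mu) ≤ numParts mu := by
  rw [← rowLen_eq_zero_iff, rowLen_down, rowLen_eq_zero_iff.2 le_rfl]

theorem sum_rowLen_addCol (n : ℕ) (mu : YoungDiagram) {k : ℕ} (hk : k ≤ n) :
    ∑ i ∈ Finset.range k, (addCol n mu).rowLen i = ∑ i ∈ Finset.range k, mu.rowLen i + k := by
  rw [Finset.sum_congr rfl fun i hi => by
    rw [rowLen_addCol, if_pos ((Finset.mem_range.1 hi).trans_le hk)]]
  simp [Finset.sum_add_distrib]

theorem card_addCol {n : ℕ} {mu : YoungDiagram} (h : numParts mu ≤ n) :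
    (addCol n mu).card = mu.card + n := by
  rw [card_eq_sum_rowLen (numParts_addCol n mu).le, sum_rowLen_addCol n mu le_rfl,
    card_eq_sum_rowLen h]

theorem dom_addCol_iff {n : ℕ} {a b : YoungDiagram} (ha : numParts a ≤ n)
    (hb : numParts b ≤ n) : Dom (addCol n a) (addCol n b) ↔ Dom a b := by
  unfold Dom
  rw [card_addCol ha, card_addCol hb, Nat.add_right_cancel_iff]
  refine and_congr_right fun hc => forall_congr' fun k => ?_
  rcases le_total k n with hk | hk
  · rw [sum_rowLen_addCol n a hk, sum_rowLen_addCol n b hk, Nat.add_le_add_iff_right]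
  · rw [← card_eq_sum_rowLen (ha.trans hk), ← card_eq_sum_rowLen (hb.trans hk),
      ← card_eq_sum_rowLen ((numParts_addCol n a).le.trans hk),
      ← card_eq_sum_rowLen ((numParts_addCol n b).le.trans hk), card_addCol ha, card_addCol hb,
      Nat.add_le_add_iff_right]

theorem numParts_le_of_mem_interval {lam rho mu : YoungDiagram} (h : mu ∈ interval lam rho) :
    numParts mu ≤ numParts lam := h.1.numParts_le

theorem bijOn_addCol_interval {n : ℕ} {lam rho : YoungDiagram} (hlam : numParts lam ≤ n)
    (hrho : numParts rho ≤ n) :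
    Set.BijOn (addCol n) (interval lam rho) (interval (addCol n lam) (addCol n rho)) := by
  have hle : ∀ mu ∈ interval lam rho, numParts mu ≤ n := fun mu hmu =>
    (numParts_le_of_mem_interval hmu).trans hlam
  refine ⟨fun mu hmu => ?_, fun mu hmu nu hnu h => ?_, fun nu hnu => ?_⟩
  · exact ⟨(dom_addCol_iff hlam (hle mu hmu)).2 hmu.1,
      (dom_addCol_iff (hle mu hmu) hrho).2 hmu.2⟩
  · rw [← down_addCol (hle mu hmu), h, down_addCol (hle nu hnu)]
  -- Both ends of the target interval have exactly n parts and the number of parts is antitone, so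
  -- `nu` has n parts and its first column can be removed.
  · have h1 := hnu.1.numParts_le
    have h2 := hnu.2.numParts_le
    rw [numParts_addCol] at h1 h2
    have h3 := le_antisymm h1 h2
    have h4 := (numParts_down_le nu).trans h1
    refine ⟨down nu, ⟨?_, ?_⟩, addCol_down h3⟩
    · rw [← dom_addCol_iff hlam h4, addCol_down h3]
      exact hnu.1
    · rw [← dom_addCol_iff h4 hrho, addCol_down h3]
      exact hnu.2

/-! ### The operations ↑, ⁺⁺ and † -/

theorem numParts_up (lam : YoungDiagram) : numParts (up lam) = numParts lam + 1 :=
  numParts_addCol _ _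

theorem down_up (lam : YoungDiagram) : down (up lam) = lam := down_addCol (Nat.le_succ _)

theorem downInvertible_up {lam : YoungDiagram} (h : numParts lam ≠ 0) :
    DownInvertible (up lam) := by
  have h1 : lam.rowLen (numParts lam) = 0 := rowLen_eq_zero_iff.2 le_rfl
  have h2 : 0 < lam.rowLen (numParts lam - 1) := lt_numParts_iff.1 (by omega)
  have h3 : (up lam).rowLen (numParts lam) = 1 := by
    rw [up, rowLen_addCol, if_pos (Nat.lt_succ_self _), h1]
  refine ⟨⟨by rw [numParts_up]; omega, ?_⟩, ?_⟩
  · rw [numParts_up, Nat.add_sub_cancel, h3,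
      show numParts lam + 1 - 2 = numParts lam - 1 by omega, up, rowLen_addCol,
      if_pos (by omega)]
    omega
  · rw [numParts_up, Nat.add_sub_cancel, h3]

theorem rowLen_plusPlus (lam : YoungDiagram) (i : ℕ) : (plusPlus lam).rowLen i =
    if i < numParts lam then
      if i < numParts lam / 2 then lam.rowLen i + 1
      else if numParts lam % 2 = 1 ∧ i = numParts lam / 2 then lam.rowLen i
      else lam.rowLen i - 1
    else 0 := rowLen_ofSeq _ _ _ i

theorem rowLen_dagger (lam : YoungDiagram) (hlam : LastDrop lam) (i : ℕ) :
    (dagger lam hlam).rowLen i =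
    if i < numParts lam then
      if i + 1 = numParts lam then lam.rowLen i
      else if numParts lam % 2 = 0 then
        if i + 1 < numParts lam / 2 then lam.rowLen i + 1
        else if i + 1 = numParts lam / 2 then lam.rowLen i
        else lam.rowLen i - 1
      else
        if i < numParts lam / 2 then lam.rowLen i + 1
        else lam.rowLen i - 1
    else 0 := rowLen_ofSeq _ _ _ i

theorem numParts_plusPlus_le (lam : YoungDiagram) : numParts (plusPlus lam) ≤ numParts lam := by
  rw [← rowLen_eq_zero_iff, rowLen_plusPlus, if_neg (lt_irrefl _)]

/-- With m = 2k + 1, λ↑ has 2(k + 1) parts. So † raises k parts, keeps the middle part of λ and the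
new last part 1, and lowers the k parts between: the same changes as ⁺⁺ on λ. -/
theorem dagger_up {lam : YoungDiagram} (hodd : Odd (numParts lam)) (h : LastDrop (up lam)) :
    dagger (up lam) h = addCol (numParts lam + 1) (plusPlus lam) := by
  obtain ⟨k, hk⟩ := hodd
  refine ext_rowLen fun i => ?_
  have h0 : i = numParts lam → lam.rowLen i = 0 := fun h => rowLen_eq_zero_iff.2 h.ge
  -- Positivity makes lowering a part commute with adding the column despite truncated subtraction.
  have h1 : i < numParts lam → 0 < lam.rowLen i := lt_numParts_iff.1
  rw [rowLen_dagger, numParts_up, up, rowLen_addCol, rowLen_addCol, rowLen_plusPlus]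
  generalize numParts lam = m at *
  generalize lam.rowLen i = a at *
  split_ifs <;> omega

/-- Among the first n parts, min n k are raised and (n - k) - (n - 2k) are lowered; the terms are
distributed over both sides to stay in ℕ. -/
theorem sum_plusPlus_even {lam : YoungDiagram} {k : ℕ} (hk : numParts lam = k + k) (n : ℕ) :
    ∑ i ∈ Finset.range n, (plusPlus lam).rowLen i + (n - k) =
      ∑ i ∈ Finset.range n, lam.rowLen i + min n k + (n - (k + k)) := by
  induction n with
  | zero => simp
  | succ n ih =>
    have h1 : n < k + k ↔ 0 < lam.rowLen n := hk ▸ lt_numParts_iff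
    rw [Finset.sum_range_succ, Finset.sum_range_succ]
    have h2 := rowLen_plusPlus lam n
    rw [hk] at h2
    split_ifs at h2 <;> omega

theorem sum_dagger_even {lam : YoungDiagram} {k : ℕ} (hk : numParts lam = k + k)
    (h : LastDrop lam) (n : ℕ) :
    ∑ i ∈ Finset.range n, (dagger lam h).rowLen i + (n - k) =
      ∑ i ∈ Finset.range n, lam.rowLen i + min n (k - 1) + (n - (k + k - 1)) := by
  induction n with
  | zero => simp
  | succ n ih =>
    have h1 : n < k + k ↔ 0 < lam.rowLen n := hk ▸ lt_numParts_iff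
    have h3 := h.1
    rw [Finset.sum_range_succ, Finset.sum_range_succ]
    have h2 := rowLen_dagger lam h n
    rw [hk] at h2
    split_ifs at h2 <;> omega

/-- For m = 2k, λ⁺⁺ arises from λ† by moving one box from row 2k up to row k. -/
theorem dom_dagger_plusPlus {lam : YoungDiagram} (heven : Even (numParts lam))
    (h : LastDrop lam) : Dom (dagger lam h) (plusPlus lam) := by
  obtain ⟨k, hk⟩ := heven
  have h3 := h.1
  refine ⟨?_, fun n => ?_⟩
  · rw [card_eq_sum_rowLen (mu := plusPlus lam) (n := numParts lam) (numParts_plusPlus_le lam),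
      card_eq_sum_rowLen (mu := dagger lam h) (n := numParts lam)]
    · have h1 := sum_plusPlus_even hk (numParts lam)
      have h2 := sum_dagger_even hk h (numParts lam)
      omega
    · rw [← rowLen_eq_zero_iff, rowLen_dagger, if_neg (lt_irrefl _)]
  · have h1 := sum_plusPlus_even hk n
    have h2 := sum_dagger_even hk h n
    omega


/-! ## Multisets of parts -/

theorem card_parts (mu : YoungDiagram) : (parts mu).card = numParts mu := by
  simp [parts, numParts]

theorem parts_add_replicate_zero {mu : YoungDiagram} {n : ℕ} (h : numParts mu ≤ n) :
    parts mu + Multiset.replicate (n - numParts mu) 0 = (Multiset.range n).map mu.rowLen := by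
  obtain ⟨k, rfl⟩ := Nat.exists_eq_add_of_le h
  rw [Nat.add_sub_cancel_left, Multiset.range_add, Multiset.map_add, Multiset.map_map]
  congr 1
  symm
  rw [Multiset.eq_replicate]
  refine ⟨by simp, fun x hx => ?_⟩
  obtain ⟨i, -, rfl⟩ := Multiset.mem_map.1 hx
  exact rowLen_eq_zero_iff.2 (Nat.le_add_right _ _)

theorem parts_addCol {n : ℕ} {mu : YoungDiagram} (h : numParts mu ≤ n) :
    parts (addCol n mu) =
      (parts mu + Multiset.replicate (n - numParts mu) 0).map (fun x => x + 1) := by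
  have h1 := parts_add_replicate_zero (numParts_addCol n mu).le
  rw [numParts_addCol, Nat.sub_self, Multiset.replicate_zero, add_zero] at h1
  rw [parts_add_replicate_zero h, h1, Multiset.map_map]
  refine Multiset.map_congr rfl fun i hi => ?_
  rw [rowLen_addCol, if_pos (Multiset.mem_range.1 hi)]
  rfl

theorem sum_parts (mu : YoungDiagram) : (parts mu).sum = mu.card := by
  have h := parts_add_replicate_zero (le_refl (numParts mu))
  rw [Nat.sub_self, Multiset.replicate_zero, add_zero] at h
  rw [h, card_eq_sum_rowLen le_rfl]
  rfl

theorem pos_of_mem_bind_parts {A : Multiset YoungDiagram} {x : ℕ} (hx : x ∈ A.bind parts) :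
    0 < x := by
  obtain ⟨mu, -, h⟩ := Multiset.mem_bind.1 hx
  exact pos_of_mem_parts h

theorem parts_phi (A : Multiset YoungDiagram) : parts (phi A) = A.bind parts :=
  parts_ofParts fun _ => pos_of_mem_bind_parts

theorem card_phi (A : Multiset YoungDiagram) : (phi A).card = (A.map YoungDiagram.card).sum := by
  rw [← sum_parts, parts_phi, Multiset.sum_bind]
  simp_rw [sum_parts]

theorem numParts_phi (A : Multiset YoungDiagram) :
    numParts (phi A) = (A.map numParts).sum := by
  rw [← card_parts, parts_phi, Multiset.card_bind]
  simp [card_parts]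

theorem card_phi_of_mem_SSP {N : ℕ} {A : Multiset YoungDiagram} (hA : A ∈ SSP N) :
    (phi A).card = N := (card_phi A).trans hA.1.2

/-- Each member, padded with zeros to two entries, contributes two boxes to the first column. -/
theorem phi_upSet {A : Multiset YoungDiagram} (hA : ∀ mu ∈ A, numParts mu ≤ 2) :
    phi (upSet A) = addCol (2 * A.card) (phi A) := by
  apply parts_injective
  have hle : (A.map numParts).sum ≤ 2 * A.card := by
    rw [mul_comm]
    simpa using Multiset.sum_le_card_nsmul (A.map numParts) 2 (by simpa using hA)
  rw [parts_addCol (by rwa [numParts_phi]), parts_phi, parts_phi, numParts_phi]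
  clear hle
  induction A using Multiset.induction_on with
  | empty => simp [upSet]
  | cons a A ih =>
    have h1 := hA a (Multiset.mem_cons_self a A)
    have h2 : ∀ mu ∈ A, numParts mu ≤ 2 := fun mu hmu => hA mu (Multiset.mem_cons_of_mem hmu)
    have hle : (A.map numParts).sum ≤ 2 * A.card := by
      rw [mul_comm]
      simpa using Multiset.sum_le_card_nsmul (A.map numParts) 2 (by simpa using h2)
    have h3 := ih h2
    simp only [upSet] at h3 ⊢
    rw [Multiset.map_cons, Multiset.cons_bind, Multiset.cons_bind, h3, parts_addCol h1,
      ← Multiset.map_add, Multiset.card_cons, Multiset.map_cons, Multiset.sum_cons,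
      show 2 * (A.card + 1) - (numParts a + (A.map numParts).sum) =
        (2 - numParts a) + (2 * A.card - (A.map numParts).sum) by omega, Multiset.replicate_add]
    congr 1
    abel

/-! ## Nested multisets -/

theorem Nested.card_filter_le {A : Multiset YoungDiagram} (h : Nested A) :
    (A.filter fun mu => numParts mu = 1).card ≤ 1 := by
  by_contra! hc
  obtain ⟨x, hx⟩ := Multiset.card_pos_iff_exists_mem.1 (Nat.zero_lt_one.trans hc)
  obtain ⟨t, ht⟩ := Multiset.exists_cons_of_mem hx
  rw [ht, Multiset.card_cons] at hc
  obtain ⟨y, hy⟩ := Multiset.card_pos_iff_exists_mem.1 (Nat.lt_of_succ_lt_succ hc)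
  have ht : ({x, y} : Multiset YoungDiagram) ≤ A.filter fun mu => numParts mu = 1 := by
    rw [ht]
    exact Multiset.cons_le_cons x (Multiset.singleton_le.2 hy)
  have h1 : ∀ z ∈ ({x, y} : Multiset YoungDiagram), numParts z = 1 := fun z hz =>
    (Multiset.mem_filter.1 (Multiset.mem_of_le ht hz)).2
  exact h x y (ht.trans (Multiset.filter_le _ _))
    (Or.inr (Or.inr ⟨h1 x (by simp), h1 y (by simp)⟩))

theorem two_mul_card_eq {A : Multiset YoungDiagram}
    (hA : ∀ mu ∈ A, 1 ≤ numParts mu ∧ numParts mu ≤ 2) :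
    2 * A.card = numParts (phi A) + (A.filter fun mu => numParts mu = 1).card := by
  rw [numParts_phi]
  induction A using Multiset.induction_on with
  | empty => simp
  | cons a A ih =>
    have h1 := hA a (Multiset.mem_cons_self a A)
    have h2 := ih fun mu hmu => hA mu (Multiset.mem_cons_of_mem hmu)
    by_cases h : numParts a = 1
    · rw [Multiset.filter_cons_of_pos (p := fun mu => numParts mu = 1) _ h]
      simp only [Multiset.card_cons, Multiset.map_cons, Multiset.sum_cons]
      omega
    · rw [Multiset.filter_cons_of_neg (p := fun mu => numParts mu = 1) _ h]
      simp only [Multiset.card_cons, Multiset.map_cons, Multiset.sum_cons]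
      omega

/-- Nestedness allows at most one one-part member, so the parity of the number of parts decides
whether it occurs. -/
theorem card_eq_of_mem_SSP {N : ℕ} {A : Multiset YoungDiagram} (hA : A ∈ SSP N) :
    A.card = (numParts (phi A) + 1) / 2 := by
  have h1 := two_mul_card_eq hA.1.1
  have h2 := hA.2.card_filter_le
  omega

/-! ### Padding and shifting nested multisets -/

theorem pair_le_of_pair_le_map {α β : Type*} {f : α → β} {s : Multiset α} {x y : β}
    (h : {x, y} ≤ s.map f) : ∃ a b, {a, b} ≤ s ∧ f a = x ∧ f b = y := by
  obtain ⟨a, ha, rfl⟩ := Multiset.mem_map.1 (Multiset.mem_of_le h (Multiset.mem_cons_self x _))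
  obtain ⟨t, rfl⟩ := Multiset.exists_cons_of_mem ha
  rw [Multiset.map_cons, Multiset.insert_eq_cons, Multiset.cons_le_cons_iff,
    Multiset.singleton_le] at h
  obtain ⟨b, hb, rfl⟩ := Multiset.mem_map.1 h
  exact ⟨a, b, Multiset.cons_le_cons a (Multiset.singleton_le.2 hb), rfl, rfl⟩

/-- Removing the empty partitions from a multiset that was padded with them. -/
theorem filter_ne_bot_add_replicate {B : Multiset YoungDiagram}
    [DecidablePred fun mu : YoungDiagram => mu ≠ ⊥] (hB : ∀ mu ∈ B, mu ≠ ⊥) (r : ℕ) :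
    (B + Multiset.replicate r ⊥).filter (fun mu => mu ≠ ⊥) = B := by
  rw [Multiset.filter_add, Multiset.filter_eq_self.2 hB, Multiset.filter_eq_nil.2, add_zero]
  intro mu hmu
  simpa using Multiset.eq_of_mem_replicate hmu

theorem ne_bot_of_mem_SP {N : ℕ} {A : Multiset YoungDiagram} (hA : A ∈ SP N)
    {mu : YoungDiagram} (hmu : mu ∈ A) : mu ≠ ⊥ := by
  rintro rfl
  have := (hA.1 _ hmu).1
  rw [numParts_bot] at this
  omega

/-- After ↑ every member has two parts, so only a crossing of type (1) can occur. Undoing the shift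
gives type (1) or, if the second partition had one part, type (2). -/
theorem nested_upSet_add_replicate {N : ℕ} {B : Multiset YoungDiagram} (hB : B ∈ SSP N)
    (r : ℕ) : Nested (upSet (B + Multiset.replicate r ⊥)) := by
  classical
  intro x y hxy
  obtain ⟨a, b, hab, rfl, rfl⟩ := pair_le_of_pair_le_map hxy
  unfold Crossing
  simp only [numParts_addCol, rowLen_addCol, Nat.zero_lt_two, Nat.one_lt_two, if_true]
  rintro (⟨-, -, h1, h2, h3⟩ | ⟨-, -, h, -⟩ | ⟨h, -⟩)
  -- The strict inequalities exclude the padding: `a` has a positive second part, which bounds the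
  -- first part of `b` from below.
  · have ha2 : 1 < numParts a := lt_numParts_iff.2 (by omega)
    have hb1 : 0 < numParts b := lt_numParts_iff.2 (by omega)
    have ha0 : a ≠ ⊥ := by
      rintro rfl
      rw [numParts_bot] at ha2
      omega
    have hb0 : b ≠ ⊥ := by
      rintro rfl
      rw [numParts_bot] at hb1
      omega
    have hle : ({a, b} : Multiset YoungDiagram) ≤ B := by
      have h4 := Multiset.filter_le_filter (fun mu : YoungDiagram => mu ≠ ⊥) hab
      rwa [filter_ne_bot_add_replicate fun mu hmu => ne_bot_of_mem_SP hB.1 hmu,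
        Multiset.filter_eq_self.2 (by simp [ha0, hb0])] at h4
    have ha3 := (hB.1.1 a (Multiset.mem_of_le hle (by simp))).2
    have hb3 := (hB.1.1 b (Multiset.mem_of_le hle (by simp))).2
    refine hB.2 a b hle ?_
    by_cases hb : numParts b = 2
    · exact Or.inl ⟨by omega, hb, by omega, by omega, by omega⟩
    · exact Or.inr (Or.inl ⟨by omega, by omega, by omega, by omega, by omega⟩)
  · omega
  · omega

theorem numParts_le_two_of_mem_add_replicate {N : ℕ} {B : Multiset YoungDiagram}
    (hB : B ∈ SP N) {r : ℕ} {mu : YoungDiagram} (hmu : mu ∈ B + Multiset.replicate r ⊥) :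
    numParts mu ≤ 2 := by
  rcases Multiset.mem_add.1 hmu with h | h
  · exact (hB.1 mu h).2
  · rw [Multiset.eq_of_mem_replicate h, numParts_bot]
    omega

theorem phi_add_replicate_bot (B : Multiset YoungDiagram) (r : ℕ) :
    phi (B + Multiset.replicate r ⊥) = phi B := by
  apply parts_injective
  rw [parts_phi, parts_phi, Multiset.add_bind, add_eq_left, Multiset.eq_zero_iff_forall_notMem]
  intro x hx
  obtain ⟨mu, hmu, hx⟩ := Multiset.mem_bind.1 hx
  rw [Multiset.eq_of_mem_replicate hmu] at hx
  have := Multiset.card_pos_iff_exists_mem.2 ⟨x, hx⟩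
  rw [card_parts, numParts_bot] at this
  omega

theorem card_add_replicate_of_mem_SSP {N m : ℕ} {B : Multiset YoungDiagram} (hB : B ∈ SSP N)
    (hm : Odd m) (hle : numParts (phi B) ≤ m) :
    2 * (B + Multiset.replicate ((m + 1) / 2 - B.card) ⊥).card = m + 1 := by
  obtain ⟨k, rfl⟩ := hm
  have := card_eq_of_mem_SSP hB
  rw [Multiset.card_add, Multiset.card_replicate]
  omega

theorem phi_upSetPad {N m : ℕ} {B : Multiset YoungDiagram} (hB : B ∈ SSP N)
    (hm : Odd m) (hle : numParts (phi B) ≤ m) :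
    phi (upSetPad m B) = addCol (m + 1) (phi B) := by
  rw [upSetPad, phi_upSet fun mu => numParts_le_two_of_mem_add_replicate hB.1,
    phi_add_replicate_bot, card_add_replicate_of_mem_SSP hB hm hle]

theorem upSetPad_mem_SSPshape {N m : ℕ} {B : Multiset YoungDiagram} (hB : B ∈ SSP N)
    (hm : Odd m) (hle : numParts (phi B) ≤ m) :
    upSetPad m B ∈ SSPshape (addCol (m + 1) (phi B)) := by
  have h := phi_upSetPad hB hm hle
  refine ⟨⟨⟨fun mu hmu => ?_, ?_⟩, nested_upSet_add_replicate hB _⟩, h⟩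
  · obtain ⟨nu, -, rfl⟩ := Multiset.mem_map.1 hmu
    rw [numParts_addCol]
    omega
  · rw [← card_phi, h]

theorem upSetPad_mem_SSP {N m : ℕ} {B : Multiset YoungDiagram} (hB : B ∈ SSP N)
    (hm : Odd m) (hle : numParts (phi B) ≤ m) : upSetPad m B ∈ SSP (N + m + 1) := by
  have h := (upSetPad_mem_SSPshape hB hm hle).1
  rwa [card_addCol (hle.trans m.le_succ), card_phi_of_mem_SSP hB] at h

theorem upSetPad_eq_upSet {N m : ℕ} {B : Multiset YoungDiagram} (hB : B ∈ SSP N)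
    (hle : numParts (phi B) = m) : upSetPad m B = upSet B := by
  rw [upSetPad, card_eq_of_mem_SSP hB, hle, Nat.sub_self, Multiset.replicate_zero, add_zero]

theorem map_down_upSet {A : Multiset YoungDiagram} (hA : ∀ mu ∈ A, numParts mu ≤ 2) :
    (upSet A).map down = A := by
  rw [upSet, Multiset.map_map]
  conv_rhs => rw [← Multiset.map_id A]
  exact Multiset.map_congr rfl fun mu hmu => down_addCol (hA mu hmu)

/-- This left inverse makes B ↦ B̂ injective, so B ≠ A gives B̂ ≠ Â when separating functions are
transferred. -/
theorem downSet_upSetPad {N : ℕ} {B : Multiset YoungDiagram} (hB : B ∈ SP N) (m : ℕ) :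
    downSet (upSetPad m B) = B := by
  classical
  unfold downSet upSetPad
  rw [map_down_upSet fun mu => numParts_le_two_of_mem_add_replicate hB]
  convert filter_ne_bot_add_replicate (fun mu hmu => ne_bot_of_mem_SP hB hmu) _


/-! ## Triangularity of products of Schur functions for the dominance order -/

/-- The sum of `(x - c)⁺` over the parts `x`, read off the exponent vector. -/
def excess (c : ℕ) : (ℕ →₀ ℕ) →+ ℕ := Finsupp.weight fun i => i + 1 - c

/-- Dominance of exponent vectors, in terms of excesses instead of partial sums. -/
def ExpDom (e e' : ℕ →₀ ℕ) : Prop := wt e' = wt e ∧ ∀ c, excess c e ≤ excess c e'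

theorem ExpDom.refl (e : ℕ →₀ ℕ) : ExpDom e e := ⟨rfl, fun _ => le_rfl⟩

theorem ExpDom.trans {a b c : ℕ →₀ ℕ} (h1 : ExpDom a b) (h2 : ExpDom b c) : ExpDom a c :=
  ⟨h2.1.trans h1.1, fun k => (h1.2 k).trans (h2.2 k)⟩

/-- Unlike partial sums of sorted parts, excesses are additive under union of parts; this is the
reason for using them. -/
theorem ExpDom.add {a b a' b' : ℕ →₀ ℕ} (h1 : ExpDom a a') (h2 : ExpDom b b') :
    ExpDom (a + b) (a' + b') := by
  refine ⟨by rw [map_add, map_add, h1.1, h2.1], fun c => ?_⟩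
  rw [map_add, map_add]
  exact add_le_add (h1.2 c) (h2.2 c)

theorem excess_expo (c : ℕ) (lam : YoungDiagram) :
    excess c (expo lam) = ∑ i : Fin (numParts lam), (lam.rowLen i - c) := by
  rw [expo_eq_sum, map_sum]
  refine Finset.sum_congr rfl fun i _ => ?_
  have := rowLen_pos lam i
  simp only [excess, Finsupp.weight_single, one_smul]
  omega

theorem excess_expo_eq_sum_range (c : ℕ) {lam : YoungDiagram} {n : ℕ}
    (h : lam.rowLen n ≤ c) :
    excess c (expo lam) = ∑ i ∈ Finset.range n, (lam.rowLen i - c) := by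
  rw [excess_expo, Fin.sum_univ_eq_sum_range (fun i => lam.rowLen i - c)]
  have key : ∀ k, lam.rowLen k ≤ c → ∑ i ∈ Finset.range k, (lam.rowLen i - c) =
      ∑ i ∈ Finset.range (max k (max n (numParts lam))), (lam.rowLen i - c) := by
    intro k hk
    refine Finset.sum_subset (Finset.range_mono (le_max_left _ _)) fun i _ hi => ?_
    have := lam.rowLen_anti k i (not_lt.1 fun h0 => hi (Finset.mem_range.2 h0))
    omega
  rw [key n h, key (numParts lam) (by rw [rowLen_eq_zero_iff.2 le_rfl]; exact c.zero_le)]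
  congr 2
  omega

theorem sum_range_sub_le_excess_expo (c : ℕ) (lam : YoungDiagram) (n : ℕ) :
    ∑ i ∈ Finset.range n, (lam.rowLen i - c) ≤ excess c (expo lam) := by
  rw [excess_expo_eq_sum_range c (n := max n (numParts lam))
    (by rw [rowLen_eq_zero_iff.2 (le_max_right _ _)]; exact c.zero_le)]
  exact Finset.sum_le_sum_of_subset (Finset.range_mono (le_max_left _ _))

theorem wt_expo_eq_card (lam : YoungDiagram) : wt (expo lam) = lam.card := by
  have h := wt_expo lam
  rw [Fin.sum_univ_eq_sum_range (fun i => (lam.rowLen i : ℤ))] at h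
  rw [card_eq_sum_rowLen le_rfl]
  exact_mod_cast h

/-- The sum of the first n parts is at most nc plus the excess over c, with equality for `mu` when c
is its part number n + 1. -/
theorem ExpDom.dom {lam mu : YoungDiagram} (h : ExpDom (expo lam) (expo mu)) : Dom lam mu := by
  refine ⟨by rw [← wt_expo_eq_card, ← wt_expo_eq_card, h.1], fun n => ?_⟩
  set c := mu.rowLen n
  have h1 := sum_range_sub_le_excess_expo c lam n
  have h2 := excess_expo_eq_sum_range c (lam := mu) (n := n) le_rfl
  have h3 : ∑ i ∈ Finset.range n, lam.rowLen i ≤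
      ∑ i ∈ Finset.range n, ((lam.rowLen i - c) + c) :=
    Finset.sum_le_sum fun i _ => by omega
  have h4 : ∑ i ∈ Finset.range n, mu.rowLen i =
      ∑ i ∈ Finset.range n, ((mu.rowLen i - c) + c) :=
    Finset.sum_congr rfl fun i hi => by
      have := mu.rowLen_anti i n (Finset.mem_range.1 hi).le
      omega
  rw [h4]
  refine h3.trans ?_
  rw [Finset.sum_add_distrib, Finset.sum_add_distrib]
  have := h.2 c
  omega

theorem prod_hsymm_excess {n : ℕ} (z : Fin n → ℤ) :
    ∏ i, hsymm (z i) = 0 ∨ ∃ e, ∏ i, hsymm (z i) = MvPolynomial.monomial e 1 ∧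
      ∀ c, excess c e = ∑ i, ((z i).toNat - c) := by
  by_cases hz : ∃ i, z i < 0
  · obtain ⟨i, hi⟩ := hz
    exact Or.inl (Finset.prod_eq_zero (Finset.mem_univ i) (by simp [hsymm, hi]))
  · push Not at hz
    right
    have key : ∀ i, ∃ e, hsymm (z i) = MvPolynomial.monomial e 1 ∧
        ∀ c, excess c e = (z i).toNat - c := by
      intro i
      rcases (hz i).eq_or_lt with h0 | h0
      · exact ⟨0, by simp [hsymm, ← h0], by simp [← h0]⟩
      · obtain ⟨k, hk⟩ : ∃ k : ℕ, z i = k + 1 := ⟨(z i - 1).toNat, by omega⟩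
        refine ⟨Finsupp.single k 1, ?_, fun c => ?_⟩
        · have h1 : ¬ (k : ℤ) + 1 < 0 := by omega
          have h2 : ¬ (k : ℤ) + 1 = 0 := by omega
          have h3 : ((k : ℤ) + 1).toNat - 1 = k := by omega
          simp only [hsymm, hk, h1, h2, h3, if_false]
          rfl
        · rw [hk, excess, Finsupp.weight_single, one_smul]
          omega
    choose e he using key
    refine ⟨∑ i, e i, ?_, fun c => ?_⟩
    · rw [MvPolynomial.monomial_sum_one]
      exact Finset.prod_congr rfl fun i _ => (he i).1
    · rw [map_sum]
      exact Finset.sum_congr rfl fun i _ => (he i).2 c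

/-- By convexity (x + d - c)⁺ ≥ (x - c)⁺ + d·[x > c]. The correction terms have nonnegative sum by
the rearrangement inequality, since [λ_i > c] decreases in i. -/
theorem excess_expo_le_perm_shift (lam : YoungDiagram) (s : Equiv.Perm (Fin (numParts lam)))
    (c : ℕ) : excess c (expo lam) ≤
      ∑ i, (((lam.rowLen (s i) : ℤ) - ((s i : ℕ) : ℤ) + ((i : ℕ) : ℤ)).toNat - c) := by
  rw [excess_expo]
  have e1 : ∑ i, (((lam.rowLen (s i) : ℤ) - ((s i : ℕ) : ℤ) + ((i : ℕ) : ℤ)).toNat - c) =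
      ∑ i : Fin (numParts lam),
        (((lam.rowLen i : ℤ) - ((i : ℕ) : ℤ) + ((s⁻¹ i : ℕ) : ℤ)).toNat - c) := by
    rw [← Equiv.sum_comp s (fun i : Fin (numParts lam) =>
      (((lam.rowLen i : ℤ) - ((i : ℕ) : ℤ) + ((s⁻¹ i : ℕ) : ℤ)).toNat - c))]
    simp
  rw [e1]
  have hanti : Antivary (fun i : Fin (numParts lam) => if c < lam.rowLen i then (1 : ℤ) else 0)
      (fun i => ((i : ℕ) : ℤ)) := by
    intro i j hij
    have h1 : (i : ℕ) < (j : ℕ) := Int.ofNat_lt.1 hij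
    have h2 := lam.rowLen_anti i j h1.le
    dsimp only
    split_ifs <;> omega
  have h1 := hanti.sum_mul_le_sum_mul_comp_perm (σ := s⁻¹)
  zify
  have h2 : ∑ i : Fin (numParts lam), (((lam.rowLen i - c : ℕ) : ℤ) +
      ((if c < lam.rowLen i then (1 : ℤ) else 0) * ((s⁻¹ i : ℕ) : ℤ) -
        (if c < lam.rowLen i then (1 : ℤ) else 0) * ((i : ℕ) : ℤ))) ≤
      ∑ i : Fin (numParts lam),
        (((((lam.rowLen i : ℤ) - ((i : ℕ) : ℤ) + ((s⁻¹ i : ℕ) : ℤ)).toNat - c : ℕ)) : ℤ) := by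
    refine Finset.sum_le_sum fun i _ => ?_
    split_ifs <;> omega
  rw [Finset.sum_add_distrib, Finset.sum_sub_distrib] at h2
  linarith

theorem expDom_of_mem_support_schur {lam : YoungDiagram} {e : ℕ →₀ ℕ}
    (he : e ∈ (schur lam).support) : ExpDom (expo lam) e := by
  classical
  refine ⟨?_, fun c => ?_⟩
  · obtain ⟨r, hr, hsupp⟩ := schur_eq lam
    by_cases h : e ∈ r.support
    · exact (hsupp e h).1
    · rw [MvPolynomial.mem_support_iff, hr, MvPolynomial.coeff_add,
        MvPolynomial.notMem_support_iff.1 h, MvPolynomial.coeff_monomial] at he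
      by_cases h0 : expo lam = e
      · rw [h0]
      · simp [h0] at he
  · unfold schur at he
    rw [Matrix.det_apply] at he
    obtain ⟨s, -, hes⟩ := Finset.mem_biUnion.1 (MvPolynomial.support_sum he)
    simp only [Matrix.of_apply] at hes
    rcases prod_hsymm_excess
      (fun i => (lam.rowLen (s i) : ℤ) - ((s i : ℕ) : ℤ) + ((i : ℕ) : ℤ)) with h0 | ⟨e', h0, hx⟩
    · rw [h0] at hes
      simp at hes
    · rw [h0] at hes
      have : e = e' := by
        rw [MvPolynomial.mem_support_iff] at hes
        by_contra hne
        apply hes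
        have h3 : MvPolynomial.coeff e (MvPolynomial.monomial e' (1 : ℝ)) = 0 := by
          rw [MvPolynomial.coeff_monomial, if_neg (Ne.symm hne)]
        rcases Int.units_eq_one_or (Equiv.Perm.sign s) with hu | hu <;> simp [hu, h3]
      subst this
      rw [hx c]
      exact excess_expo_le_perm_shift lam s c

/-- Replacing h_μ by s_μ leaves monomials that dominate μ and have a larger sum of squares, which is
bounded in fixed degree; transitivity carries dominance through the induction. -/
theorem monomial_mem_span_schur_expDom (k : ℕ) : ∀ e : ℕ →₀ ℕ, wt e ^ 2 - sq e = k →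
    MvPolynomial.monomial e (1 : ℝ) ∈
      Submodule.span ℝ (schur '' {mu | ExpDom e (expo mu)}) := by
  induction k using Nat.strong_induction_on with
  | _ k ih =>
    intro e hk
    obtain ⟨mu, rfl⟩ := expo_surjective e
    obtain ⟨r, hr, hsupp⟩ := schur_eq mu
    rw [eq_sub_iff_add_eq.2 hr.symm]
    refine Submodule.sub_mem _ (Submodule.subset_span ⟨mu, ExpDom.refl _, rfl⟩) ?_
    rw [r.as_sum]
    refine Submodule.sum_mem _ fun e he => ?_
    obtain ⟨hw, hq⟩ := hsupp e he
    have h1 := sq_le_wt_sq e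
    rw [← mul_one (MvPolynomial.coeff e r), ← smul_eq_mul, ← MvPolynomial.smul_monomial]
    have hdom : ExpDom (expo mu) e := by
      apply expDom_of_mem_support_schur
      have hne : expo mu ≠ e := fun h => hq.ne (by rw [h])
      rw [MvPolynomial.mem_support_iff, hr, MvPolynomial.coeff_add, MvPolynomial.coeff_monomial,
        if_neg hne, zero_add]
      exact MvPolynomial.mem_support_iff.1 he
    refine Submodule.smul_mem _ _ (Submodule.span_mono (Set.image_mono ?_) (ih _ ?_ e rfl))
    · exact fun nu hnu => hdom.trans hnu
    · rw [hw] at h1 ⊢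
      omega

theorem expo_phi (A : Multiset YoungDiagram) : expo (phi A) = (A.map expo).sum := by
  rw [expo, parts_phi]
  induction A using Multiset.induction_on with
  | empty => simp
  | cons a A ih =>
    rw [Multiset.cons_bind, Multiset.map_add, map_add, ih, Multiset.map_cons, Multiset.sum_cons]
    rfl

theorem expDom_of_mem_support_schurProd (A : Multiset YoungDiagram) :
    ∀ e ∈ (schurProd A).support, ExpDom (expo (phi A)) e := by
  classical
  simp only [expo_phi]
  induction A using Multiset.induction_on with
  | empty =>
    intro e he
    have h : e = 0 := by
      by_contra h0
      rw [MvPolynomial.mem_support_iff, schurProd, Multiset.map_zero, Multiset.prod_zero,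
        MvPolynomial.coeff_one, if_neg (Ne.symm h0)] at he
      exact he rfl
    simpa [h] using ExpDom.refl 0
  | cons a A ih =>
    intro e he
    rw [schurProd, Multiset.map_cons, Multiset.prod_cons] at he
    obtain ⟨x, hx, y, hy, rfl⟩ := Finset.mem_add.1 (MvPolynomial.support_mul _ _ he)
    rw [Multiset.map_cons, Multiset.sum_cons]
    exact (expDom_of_mem_support_schur hx).add (ih y hy)

theorem schurProd_mem_span (A : Multiset YoungDiagram) :
    schurProd A ∈ Submodule.span ℝ (schur '' {mu | Dom (phi A) mu}) := by
  rw [(schurProd A).as_sum]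
  refine Submodule.sum_mem _ fun e he => ?_
  rw [← mul_one (MvPolynomial.coeff e _), ← smul_eq_mul, ← MvPolynomial.smul_monomial]
  refine Submodule.smul_mem _ _ (Submodule.span_mono (Set.image_mono fun mu hmu => ?_)
    (monomial_mem_span_schur_expDom _ e rfl))
  exact ((expDom_of_mem_support_schurProd A e he).trans hmu).dom

/-! ### Schur coordinates and enlarging the interval -/

theorem schurBasis_apply (mu : YoungDiagram) : schurBasis mu = schur mu := by
  rw [schurBasis, Module.Basis.mk_apply]

theorem coe_schurBasis : ⇑schurBasis = schur := funext schurBasis_apply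

theorem repr_schur (mu : YoungDiagram) : schurBasis.repr (schur mu) = Finsupp.single mu 1 := by
  rw [← schurBasis_apply, schurBasis.repr_self]

theorem dom_of_repr_schurProd_ne_zero {A : Multiset YoungDiagram} {mu : YoungDiagram}
    (h : schurBasis.repr (schurProd A) mu ≠ 0) : Dom (phi A) mu := by
  have h1 := schurProd_mem_span A
  rw [← coe_schurBasis, schurBasis.mem_span_image] at h1
  exact h1 (Finsupp.mem_support_iff.2 h)

theorem innp_schur_right (f : Sym) (mu : YoungDiagram) :
    innp f (schur mu) = schurBasis.repr f mu := by
  classical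
  rw [innp, repr_schur, Finsupp.sum, Finset.sum_eq_single mu]
  · simp
  · intro nu _ h
    simp [h.symm]
  · intro h
    simp [Finsupp.notMem_support_iff.1 h]

theorem innp_schur_left (mu : YoungDiagram) (g : Sym) :
    innp (schur mu) g = schurBasis.repr g mu := by
  rw [innp, repr_schur, Finsupp.sum_single_index (by simp), one_mul]

theorem SeparatesOn.mono {N : ℕ} {f : Sym} {A : Multiset YoungDiagram}
    {lam rho rho' : YoungDiagram} (h : SeparatesOn N f A lam rho) (hrho : Dom rho rho') :
    SeparatesOn N f A lam rho' := by
  refine ⟨fun mu hmu => h.support mu fun h1 => hmu ⟨h1.1, h1.2.trans hrho⟩, h.pos,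
    fun B hB hphi hne => ?_⟩
  by_cases h1 : Dom (phi B) rho
  · exact h.nonpos B hB ⟨hphi.1, h1⟩ hne
  -- A `mu` occurring in both factors would satisfy φ(B) ⊴ μ ⊴ ρ, contrary to `h1`; so the pairing
  -- vanishes termwise.
  · refine (Finset.sum_eq_zero fun mu _ => ?_).le
    change schurBasis.repr f mu * schurBasis.repr (schurProd B) mu = 0
    by_cases h2 : schurBasis.repr (schurProd B) mu = 0
    · rw [h2, mul_zero]
    · have h3 := h.support mu fun h4 => h1 ((dom_of_repr_schurProd_ne_zero h2).trans h4.2)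
      rw [innp_schur_right] at h3
      rw [h3, zero_mul]


/-! ## Removing a first column -/

open Polynomial in
/-- The ring homomorphism `h_z ↦ h_z + t h_{z-1}`; the coefficient of `t ^ n` is the adjoint of
the multiplication by the elementary symmetric function `e_n`. -/
def colHom : Sym →ₐ[ℝ] Polynomial Sym :=
  MvPolynomial.aeval fun i => X * C (hsymm i) + C (MvPolynomial.X i)

open Polynomial in
theorem colHom_hsymm (z : ℤ) : colHom (hsymm z) = X * C (hsymm (z - 1)) + C (hsymm z) := by
  rcases lt_trichotomy z 0 with h | h | h
  · simp [hsymm, h, show z - 1 < 0 by omega]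
  · subst h
    simp [hsymm]
  · obtain ⟨k, rfl⟩ : ∃ k : ℕ, z = k + 1 := ⟨(z - 1).toNat, by omega⟩
    have h1 : hsymm ((k : ℤ) + 1) = MvPolynomial.X k := by
      have h1 : ¬ (k : ℤ) + 1 < 0 := by omega
      have h2 : ¬ (k : ℤ) + 1 = 0 := by omega
      have h3 : ((k : ℤ) + 1).toNat - 1 = k := by omega
      simp only [hsymm, h1, h2, h3, if_false]
    rw [h1, add_sub_cancel_right, colHom, MvPolynomial.aeval_X]

/-- The Jacobi-Trudi determinant does not change when empty rows are added. -/
theorem det_hsymm_eq_schur {lam : YoungDiagram} {n : ℕ} (h : numParts lam ≤ n) :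
    Matrix.det (Matrix.of fun i j : Fin n =>
      hsymm ((lam.rowLen i : ℤ) - (i : ℤ) + (j : ℤ))) = schur lam := by
  induction n, h using Nat.le_induction with
  | base => rfl
  | succ n hn ih =>
    have h0 : lam.rowLen n = 0 := rowLen_eq_zero_iff.2 hn
    rw [Matrix.det_succ_row _ (Fin.last n), Finset.sum_eq_single (Fin.last n)]
    · rw [← ih]
      have h1 : hsymm 0 = 1 := by simp [hsymm]
      simp only [Matrix.of_apply, Fin.val_last, h0, Nat.cast_zero, zero_sub, neg_add_cancel, h1,
        ← two_mul, pow_mul, neg_one_sq, one_pow, one_mul, mul_one]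
      congr 1
      ext1 i j
      simp
    · intro j _ hj
      have h1 : (j : ℕ) < n := Fin.val_lt_last hj
      have h2 : hsymm (-(n : ℤ) + (j : ℤ)) = 0 := by
        rw [hsymm, if_pos (by omega)]
      simp only [Matrix.of_apply, Fin.val_last, h0, Nat.cast_zero, zero_sub, h2, mul_zero,
        zero_mul]
    · intro h1
      exact absurd (Finset.mem_univ _) h1

open Polynomial in
theorem colHom_schur {lam : YoungDiagram} {n : ℕ} (h : numParts lam ≤ n) :
    colHom (schur lam) = Matrix.det ((X : Sym[X]) •
      (Matrix.of fun i j : Fin n => hsymm ((lam.rowLen i : ℤ) - (i : ℤ) + (j : ℤ) - 1)).map C +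
      (Matrix.of fun i j : Fin n => hsymm ((lam.rowLen i : ℤ) - (i : ℤ) + (j : ℤ))).map C) := by
  rw [← det_hsymm_eq_schur h, AlgHom.map_det]
  congr 1
  ext1 i j
  simp [colHom_hsymm]

theorem natDegree_colHom_schur {lam : YoungDiagram} {n : ℕ} (h : numParts lam ≤ n) :
    (colHom (schur lam)).natDegree ≤ n := by
  rw [colHom_schur h]
  exact (Polynomial.natDegree_det_X_add_C_le _ _).trans (Fintype.card_fin n).le

/-- The top coefficient of det(tP + Q) is det P, and here P is the Jacobi-Trudi matrix with every
part lowered by 1. -/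
theorem coeff_colHom_schur {lam : YoungDiagram} {n : ℕ} (h : numParts lam ≤ n) :
    (colHom (schur lam)).coeff n = if numParts lam = n then schur (down lam) else 0 := by
  have h1 := Polynomial.coeff_det_X_add_C_card
    (Matrix.of fun i j : Fin n => hsymm ((lam.rowLen i : ℤ) - (i : ℤ) + (j : ℤ) - 1))
    (Matrix.of fun i j : Fin n => hsymm ((lam.rowLen i : ℤ) - (i : ℤ) + (j : ℤ)))
  rw [Fintype.card_fin, ← colHom_schur h] at h1
  rw [h1]
  split_ifs with hn
  · rw [← det_hsymm_eq_schur ((numParts_down_le lam).trans h)]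
    congr 1
    ext1 i j
    have h2 : 0 < lam.rowLen i := lt_numParts_iff.1 (hn.symm ▸ i.2)
    rw [Matrix.of_apply, Matrix.of_apply, rowLen_down]
    congr 1
    omega
  -- When the n-th part is 0, the last row consists of h_{j - n} with j < n, all zero.
  · refine Matrix.det_eq_zero_of_row_eq_zero ⟨n - 1, by omega⟩ fun j => ?_
    have h2 : lam.rowLen (n - 1) = 0 := rowLen_eq_zero_iff.2 (by omega)
    have h3 := j.2
    rw [Matrix.of_apply, hsymm, if_pos]
    simp only [h2]
    omega

theorem schur_bot : schur ⊥ = 1 := by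
  rw [← det_hsymm_eq_schur (n := 0) numParts_bot.le]
  exact Matrix.det_isEmpty

/-- Taking the coefficient of `t ^ n` removes a first column of length `n`. -/
theorem repr_coeff_colHom {n : ℕ} {F : Sym}
    (hF : ∀ nu, schurBasis.repr F nu ≠ 0 → numParts nu ≤ n) {rho : YoungDiagram}
    (hrho : numParts rho ≤ n) :
    schurBasis.repr ((colHom F).coeff n) rho = schurBasis.repr F (addCol n rho) := by
  classical
  have hmem : F ∈ Submodule.span ℝ (schur '' {nu | numParts nu ≤ n}) := by
    rw [← coe_schurBasis, schurBasis.mem_span_image]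
    exact fun nu hnu => hF nu (Finsupp.mem_support_iff.1 hnu)
  clear hF
  induction hmem using Submodule.span_induction with
  | zero => simp
  | add x y _ _ hx hy => simp [hx, hy]
  | smul a x _ hx => simp [hx]
  | mem x hx =>
    obtain ⟨nu, hnu, rfl⟩ := hx
    rw [coeff_colHom_schur hnu, repr_schur]
    by_cases h : numParts nu = n
    · rw [if_pos h, repr_schur, Finsupp.single_apply, Finsupp.single_apply]
      refine if_congr ⟨fun h1 => ?_, fun h1 => ?_⟩ rfl rfl
      · rw [← h1, addCol_down h]
      · rw [h1, down_addCol hrho]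
    · rw [if_neg h, Finsupp.single_eq_of_ne, map_zero, Finsupp.zero_apply]
      intro h1
      exact h (by rw [← h1, numParts_addCol])

/-- Let `mu` be a longest partition occurring in F, with ℓ parts. The coefficient of s_{μ↓} in the
t^ℓ-coefficient is that of s_μ in F, hence nonzero, so ℓ is at most the degree. -/
theorem numParts_le_of_natDegree_colHom_le {n : ℕ} {F : Sym}
    (hF : (colHom F).natDegree ≤ n) {nu : YoungDiagram} (hnu : schurBasis.repr F nu ≠ 0) :
    numParts nu ≤ n := by
  obtain ⟨mu, hmu, hmax⟩ := Finset.exists_max_image (schurBasis.repr F).support numParts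
    ⟨nu, Finsupp.mem_support_iff.2 hnu⟩
  refine (hmax nu (Finsupp.mem_support_iff.2 hnu)).trans (not_lt.1 fun hlt => ?_)
  have h := repr_coeff_colHom (n := numParts mu) (F := F)
    (fun nu hnu => hmax nu (Finsupp.mem_support_iff.2 hnu)) (numParts_down_le mu)
  rw [addCol_down rfl, Polynomial.coeff_eq_zero_of_natDegree_lt (hF.trans_lt hlt), map_zero] at h
  exact Finsupp.mem_support_iff.1 hmu h.symm

/-! ### Column removal on products of Schur functions -/

theorem schurProd_add_replicate_bot (B : Multiset YoungDiagram) (r : ℕ) :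
    schurProd (B + Multiset.replicate r ⊥) = schurProd B := by
  rw [schurProd, Multiset.map_add, Multiset.prod_add, Multiset.map_replicate, schur_bot,
    Multiset.prod_replicate, one_pow, mul_one, schurProd]

theorem colHom_schurProd (D : Multiset YoungDiagram) :
    colHom (schurProd D) = (D.map fun mu => colHom (schur mu)).prod := by
  rw [schurProd, map_multiset_prod, Multiset.map_map]
  rfl

theorem natDegree_colHom_schurProd_upSet (D : Multiset YoungDiagram) :
    (colHom (schurProd (upSet D))).natDegree ≤ 2 * D.card := by
  rw [colHom_schurProd, upSet, Multiset.map_map]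
  refine (Polynomial.natDegree_multiset_prod_le _).trans ?_
  rw [Multiset.map_map, mul_comm]
  refine (Multiset.sum_le_card_nsmul _ 2 fun x hx => ?_).trans (by simp)
  obtain ⟨mu, -, rfl⟩ := Multiset.mem_map.1 hx
  exact natDegree_colHom_schur (numParts_addCol 2 mu).le

/-- Each factor has degree at most 2, so the coefficient of t^(2|D|) is the product of the
t²-coefficients. -/
theorem coeff_colHom_schurProd_upSet {D : Multiset YoungDiagram}
    (hD : ∀ mu ∈ D, numParts mu ≤ 2) :
    (colHom (schurProd (upSet D))).coeff (2 * D.card) = schurProd D := by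
  have h := Polynomial.coeff_multiset_prod_of_natDegree_le
    ((upSet D).map fun mu => colHom (schur mu)) 2 (by
      intro p hp
      obtain ⟨mu, hmu, rfl⟩ := Multiset.mem_map.1 hp
      obtain ⟨nu, -, rfl⟩ := Multiset.mem_map.1 hmu
      exact natDegree_colHom_schur (numParts_addCol 2 nu).le)
  rw [← colHom_schurProd, Multiset.card_map, Multiset.map_map, upSet, Multiset.card_map,
    Multiset.map_map, mul_comm] at h
  rw [upSet, h, schurProd]
  congr 1
  refine Multiset.map_congr rfl fun mu hmu => ?_
  simp only [Function.comp_apply]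
  rw [coeff_colHom_schur (numParts_addCol 2 mu).le, if_pos (numParts_addCol 2 mu),
    down_addCol (hD mu hmu)]

theorem repr_schurProd_upSetPad {N m : ℕ} {B : Multiset YoungDiagram} (hB : B ∈ SSP N)
    (hm : Odd m) (hle : numParts (phi B) ≤ m) {rho : YoungDiagram} (hrho : numParts rho ≤ m) :
    schurBasis.repr (schurProd (upSetPad m B)) (addCol (m + 1) rho) =
      schurBasis.repr (schurProd B) rho := by
  have hcard := card_add_replicate_of_mem_SSP hB hm hle
  have h1 := natDegree_colHom_schurProd_upSet
    (B + Multiset.replicate ((m + 1) / 2 - B.card) ⊥)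
  have h2 := coeff_colHom_schurProd_upSet
    (D := B + Multiset.replicate ((m + 1) / 2 - B.card) ⊥)
    fun mu => numParts_le_two_of_mem_add_replicate hB.1
  rw [hcard] at h1 h2
  rw [upSetPad, ← repr_coeff_colHom (fun nu => numParts_le_of_natDegree_colHom_le h1)
    (hrho.trans m.le_succ), h2, schurProd_add_replicate_bot]

/-! ## Transfer of separating functions -/

/-- The linear map `s_mu ↦ s_{mu↓}`. -/
def schurDown : Sym →ₗ[ℝ] Sym := schurBasis.constr ℝ fun mu => schur (down mu)

/-- `down` is not injective, so coefficients may merge; summing over the original indices avoids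
describing the fibres. -/
theorem innp_schurDown (f h : Sym) :
    innp (schurDown f) h =
      (schurBasis.repr f).sum fun nu c => c * schurBasis.repr h (down nu) := by
  have h1 : schurBasis.repr (schurDown f) = Finsupp.mapDomain down (schurBasis.repr f) := by
    rw [schurDown, Module.Basis.constr_apply, Finsupp.mapDomain, map_finsuppSum]
    refine Finsupp.sum_congr fun nu _ => ?_
    rw [map_smul, repr_schur, Finsupp.smul_single, smul_eq_mul, mul_one]
  rw [innp, h1, Finsupp.sum_mapDomain_index (fun _ => zero_mul _) fun _ _ _ => add_mul _ _ _]

/-- The support of `f` lies in the image of `addCol (m + 1)`, where `down` inverts it. Equality of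
coefficients then makes the new function pair with s_B as `f` does with s_B̂. -/
theorem separatesOn_schurDown {N m : ℕ} {A : Multiset YoungDiagram} {lam rho : YoungDiagram}
    {f : Sym} (hA : A ∈ SSP N) (hphi : numParts (phi A) ≤ m) (hm : Odd m)
    (hlam : numParts lam ≤ m) (hrho : numParts rho ≤ m)
    (h : SeparatesOn (N + m + 1) f (upSetPad m A) (addCol (m + 1) lam) (addCol (m + 1) rho)) :
    SeparatesOn N (schurDown f) A lam rho := by
  have hbij := bijOn_addCol_interval (hlam.trans m.le_succ) (hrho.trans m.le_succ)
  have hmem : ∀ nu, schurBasis.repr f nu ≠ 0 →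
      ∃ mu ∈ interval lam rho, numParts mu ≤ m ∧ addCol (m + 1) mu = nu := by
    intro nu hnu
    by_contra hc
    refine hnu ?_
    rw [← innp_schur_right]
    refine h.support nu fun h1 => hc ?_
    obtain ⟨mu, hmu, h2⟩ := hbij.surjOn h1
    exact ⟨mu, hmu, (numParts_le_of_mem_interval hmu).trans hlam, h2⟩
  have key : ∀ B ∈ SSP N, numParts (phi B) ≤ m →
      innp (schurDown f) (schurProd B) = innp f (schurProd (upSetPad m B)) := by
    intro B hB hle
    rw [innp_schurDown, innp]
    refine Finsupp.sum_congr fun nu hnu => ?_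
    obtain ⟨mu, -, hmu, rfl⟩ := hmem nu (Finsupp.mem_support_iff.1 hnu)
    rw [down_addCol (hmu.trans m.le_succ), repr_schurProd_upSetPad hB hm hle hmu]
  refine ⟨fun mu hmu => ?_, ?_, fun B hB hB1 hne => ?_⟩
  · rw [innp_schurDown]
    refine Finset.sum_eq_zero fun nu hnu => ?_
    obtain ⟨ka, hka, hle, rfl⟩ := hmem nu (Finsupp.mem_support_iff.1 hnu)
    beta_reduce
    rw [down_addCol (hle.trans (Nat.le_add_right m 1)), repr_schur, Finsupp.single_eq_of_ne, mul_zero]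
    rintro rfl
    exact hmu hka
  · rw [key A hA hphi]
    exact h.pos
  · have hle := (numParts_le_of_mem_interval hB1).trans hlam
    rw [key B hB hle]
    refine h.nonpos _ (upSetPad_mem_SSP hB hm hle) ?_ fun h1 => hne ?_
    · rw [phi_upSetPad hB hm hle]
      exact hbij.mapsTo hB1
    · rw [← downSet_upSetPad hB.1 m, h1, downSet_upSetPad hA.1 m]

/-! ### Odd shapes and the implication between the conjectures -/

theorem exists_separatesOn_of_upSet {N : ℕ} {A : Multiset YoungDiagram} (hA : A ∈ SSP N)
    (hm : Odd (numParts (phi A))) (hd : LastDrop (up (phi A)))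
    (h : ∃ f, SeparatesOn (N + numParts (phi A) + 1) f (upSet A) (up (phi A))
      (dagger (up (phi A)) hd)) :
    ∃ g, SeparatesOn N g A (phi A) (plusPlus (phi A)) := by
  obtain ⟨f, hf⟩ := h
  rw [dagger_up hm, ← upSetPad_eq_upSet hA rfl] at hf
  exact ⟨schurDown f, separatesOn_schurDown hA le_rfl hm le_rfl (numParts_plusPlus_le _) hf⟩

theorem upSet_mem_SSPshape {N : ℕ} {A : Multiset YoungDiagram} (hA : A ∈ SSP N)
    (hm : Odd (numParts (phi A))) : upSet A ∈ SSPshape (up (phi A)) := by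
  rw [← upSetPad_eq_upSet hA rfl]
  exact upSetPad_mem_SSPshape hA hm le_rfl

theorem StrongConjecture.plusPlusConjecture (h : StrongConjecture) : PlusPlusConjecture := by
  intro N A hA
  rcases Nat.even_or_odd (numParts (phi A)) with heven | hodd
  · by_cases hd : DownInvertible (phi A) ∧ downSet A ∈ SSPshape (down (phi A))
    · obtain ⟨f, hf⟩ := (h N A hA heven).1 hd.1 hd.2
      exact ⟨f, hf.mono (dom_dagger_plusPlus heven hd.1.1)⟩
    · exact (h N A hA heven).2 hd
  · have hd := downInvertible_up (lam := phi A) hodd.pos.ne'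
    refine exists_separatesOn_of_upSet hA hodd hd.1 ?_
    have hup := upSet_mem_SSPshape hA hodd
    have hmem : upSet A ∈ SSP (N + numParts (phi A) + 1) := by
      rw [← upSetPad_eq_upSet hA rfl]
      exact upSetPad_mem_SSP hA hodd le_rfl
    have hdown : downSet (upSet A) = A := by
      rw [← upSetPad_eq_upSet hA rfl, downSet_upSetPad hA.1]
    -- λ↑ is even and A↑ falls under the †-case, because (A↑)↓ = A is nested of shape (λ↑)↓ = λ.
    have h1 := (h _ _ hmem (by rw [hup.2, numParts_up]; exact hodd.add_one)).1
    simp only [hup.2, hdown, down_up] at h1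
    exact h1 hd ⟨by rwa [card_phi_of_mem_SSP hA], rfl⟩

end SchurCone

end

theorem mainTheorem4 :
    (SchurCone.StrongConjecture → SchurCone.PlusPlusConjecture) ∧
    ∀ (N m : ℕ) (A : Multiset YoungDiagram) (lam : YoungDiagram),
      A ∈ SchurCone.SSP N → SchurCone.phi A = lam → SchurCone.numParts lam = m → Odd m →
      ∃ hd : SchurCone.DownInvertible (SchurCone.up lam),
        -- the image of `A` is a nested multiset of shape `lam↑`
        SchurCone.upSet A ∈ SchurCone.SSPshape (SchurCone.up lam) ∧
        -- adding a first column of length `m + 1` is an isomorphism of the two intervals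
        Set.BijOn (SchurCone.addCol (m + 1))
          (SchurCone.interval lam (SchurCone.plusPlus lam))
          (SchurCone.interval (SchurCone.up lam)
            (SchurCone.dagger (SchurCone.up lam) hd.1)) ∧
        (∀ rho ∈ SchurCone.interval lam (SchurCone.plusPlus lam),
          ∀ rho' ∈ SchurCone.interval lam (SchurCone.plusPlus lam),
            (SchurCone.Dom (SchurCone.addCol (m + 1) rho) (SchurCone.addCol (m + 1) rho') ↔
              SchurCone.Dom rho rho')) ∧
        -- the coefficients on the two intervals agree
        (∀ B ∈ SchurCone.SSP N,
          SchurCone.phi B ∈ SchurCone.interval lam (SchurCone.plusPlus lam) →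
          SchurCone.upSetPad m B ∈
            SchurCone.SSPshape (SchurCone.addCol (m + 1) (SchurCone.phi B)) ∧
          (SchurCone.numParts (SchurCone.phi B) = m →
            SchurCone.upSetPad m B = SchurCone.upSet B) ∧
          ∀ rho ∈ SchurCone.interval lam (SchurCone.plusPlus lam),
            SchurCone.innp (SchurCone.schur rho) (SchurCone.schurProd B) =
              SchurCone.innp (SchurCone.schur (SchurCone.addCol (m + 1) rho))
                (SchurCone.schurProd (SchurCone.upSetPad m B))) ∧
        -- separating functions transfer
        ((∃ f : SchurCone.Sym, SchurCone.SeparatesOn (N + m + 1) f (SchurCone.upSet A)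
            (SchurCone.up lam) (SchurCone.dagger (SchurCone.up lam) hd.1)) →
          ∃ g : SchurCone.Sym,
            SchurCone.SeparatesOn N g A lam (SchurCone.plusPlus lam)) := by
  open SchurCone in
  refine ⟨StrongConjecture.plusPlusConjecture, ?_⟩
  rintro N m A lam hA rfl rfl hm
  have hle : ∀ rho ∈ interval (phi A) (plusPlus (phi A)), numParts rho ≤ numParts (phi A) :=
    fun rho => numParts_le_of_mem_interval
  refine ⟨downInvertible_up hm.pos.ne', upSet_mem_SSPshape hA hm, ?_, ?_, ?_,
    exists_separatesOn_of_upSet hA hm _⟩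
  · rw [dagger_up hm]
    exact bijOn_addCol_interval (Nat.le_succ _) ((numParts_plusPlus_le _).trans (Nat.le_succ _))
  · intro rho hrho rho' hrho'
    exact dom_addCol_iff ((hle rho hrho).trans (Nat.le_succ _))
      ((hle rho' hrho').trans (Nat.le_succ _))
  · intro B hB hphi
    refine ⟨upSetPad_mem_SSPshape hB hm (hle _ hphi), upSetPad_eq_upSet hB, fun rho hrho => ?_⟩
    rw [innp_schur_left, innp_schur_left, repr_schurProd_upSetPad hB hm (hle _ hphi) (hle _ hrho)]
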